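/- For real numbers $c, s$, MAX 3SAT$(c,s)$ is the following promise problem about nonempty 3-CNF formulas (lists of clauses with three, possibly repeated, literals): a YES instance is a formula for which some assignment satisfies at least a $c$ fraction of the clauses, and a NO instance is a formula for which every assignment satisfies at most an $s$ fraction of the clauses. A randomized algorithm for MAX 3SAT$(c,s)$ has no false positives if it accepts every YES instance with probability at least $1/2$ and accepts a NO instance with probability $0$. As in the Gap Exponential-Time Hypothesis (Gap-ETH), instances have $n$ variables and $m=O(n)$ clauses, and the problem is said to have a randomized $2^{o(n)}$-time algorithm with no false positives if for every constant $\rho$ and every constant $\delta>0$ there is a randomized algorithm with no false positives for the instances with at most $\rho n$ clauses which runs in time $O(2^{\delta n})$ (for all inputs with at most $\rho n$ clauses and all outcomes of its coin tosses). Theorem. If MAX 3SAT$(1,1-\gamma)$ has a randomized $2^{o(n)}$-time algorithm with no false positives for every constant $\gamma>0$, then MAX 3SAT$(s(1+\epsilon),s)$ has a randomized $2^{o(n)}$-time algorithm with no false positives for all constants $s,\epsilon>0$. The converse holds as well; that is, Gap-ETH with perfect completeness and Gap-ETH without perfect completeness are equivalent for randomized algorithms with no false positives. -/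

import Mathlib

/-! ### 3-CNF formulas and the gap problem -/

namespace MaxSat

/-- A literal over the variables `0, …, n - 1`: the pair `(i, b)` is the literal that is true
exactly when variable `i` has the value `b`. -/
abbrev Literal (n : ℕ) : Type := Fin n × Bool

/-- A clause is a disjunction of three literals; repeating a literal gives shorter clauses. -/
abbrev Clause (n : ℕ) : Type := Literal n × Literal n × Literal n

/-- A 3-CNF formula on `n` variables: a list of clauses. -/
abbrev Formula (n : ℕ) : Type := List (Clause n)

/-- The truth value of a literal under an assignment. -/
def Literal.eval {n : ℕ} (x : Fin n → Bool) (l : Literal n) : Bool := x l.1 == l.2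

/-- The truth value of a clause under an assignment. -/
def Clause.eval {n : ℕ} (x : Fin n → Bool) (c : Clause n) : Bool :=
  Literal.eval x c.1 || Literal.eval x c.2.1 || Literal.eval x c.2.2

/-- The fraction of the clauses of `φ` that the assignment `x` satisfies. -/
noncomputable def satFraction {n : ℕ} (φ : Formula n) (x : Fin n → Bool) : ℝ :=
  (φ.countP (Clause.eval x) : ℝ) / (φ.length : ℝ)

/-- YES instances with completeness `c`: some assignment satisfies at least a `c` fraction of the
clauses (of a formula with at least one clause). -/
def IsYes (c : ℝ) {n : ℕ} (φ : Formula n) : Prop :=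
  φ ≠ [] ∧ ∃ x : Fin n → Bool, c ≤ satFraction φ x

/-- NO instances with soundness `s`: every assignment satisfies at most an `s` fraction of the
clauses (of a formula with at least one clause). -/
def IsNo (s : ℝ) {n : ℕ} (φ : Formula n) : Prop :=
  φ ≠ [] ∧ ∀ x : Fin n → Bool, satFraction φ x ≤ s

/-! ### Encoding of formulas as bit strings -/

/-- The unary, self-delimiting encoding of a natural number: `k` ones followed by a zero. -/
def encodeNat (k : ℕ) : List Bool := List.replicate k true ++ [false]

/-- A literal: its sign bit, followed by the index of its variable. -/
def encodeLiteral {n : ℕ} (l : Literal n) : List Bool := l.2 :: encodeNat l.1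

/-- A clause: its three literals. -/
def encodeClause {n : ℕ} (c : Clause n) : List Bool :=
  encodeLiteral c.1 ++ encodeLiteral c.2.1 ++ encodeLiteral c.2.2

/-- A formula: the number of variables, the number of clauses, and then the clauses in order.
The length is polynomial in the numbers of variables and of clauses. -/
def encode {n : ℕ} (φ : Formula n) : List Bool :=
  encodeNat n ++ encodeNat φ.length ++ φ.flatMap encodeClause

/-! ### Randomized machines with a step count

A randomized multi-stack machine: finitely many stacks of bits (those that the program mentions), a
finite control given by a structured program, and a fair coin. One step pushes, pops or tosses, or
inspects the top of one stack to decide how to continue, so that this is, up to constant factors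
in the running time, a probabilistic multi-tape Turing machine. -/

/-- Programs. Stacks are named by natural numbers. -/
inductive Prog : Type
  /-- do nothing -/
  | nop : Prog
  /-- push the bit `b` on stack `r` -/
  | push (r : ℕ) (b : Bool) : Prog
  /-- remove the top of stack `r` (no effect if it is empty) -/
  | pop (r : ℕ) : Prog
  /-- push the outcome of a fresh fair coin toss on stack `r` -/
  | toss (r : ℕ) : Prog
  /-- run `p`, then `q` -/
  | seq (p q : Prog) : Prog
  /-- run `pT`, `pF` or `pE` if the top of stack `r` is `true`, is `false`, or does not exist -/
  | branch (r : ℕ) (pT pF pE : Prog) : Prog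
  /-- as long as stack `r` is nonempty, run `p` -/
  | loop (r : ℕ) (p : Prog) : Prog

/-- The contents of the stacks, tops first. -/
abbrev Store : Type := ℕ → List Bool

/-- A configuration: what remains to be executed, and the contents of the stacks. -/
structure Config where
  /-- the programs that remain to be executed, in this order -/
  todo : List Prog
  /-- the contents of the stacks -/
  store : Store

/-- One step of computation: the distribution of the next configuration. Halted configurations
do not change. -/
noncomputable def step : Config → PMF Config
  | ⟨[], σ⟩ => PMF.pure ⟨[], σ⟩
  | ⟨.nop :: k, σ⟩ => PMF.pure ⟨k, σ⟩
  | ⟨.push r b :: k, σ⟩ => PMF.pure ⟨k, Function.update σ r (b :: σ r)⟩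
  | ⟨.pop r :: k, σ⟩ => PMF.pure ⟨k, Function.update σ r (σ r).tail⟩
  | ⟨.toss r :: k, σ⟩ =>
      (PMF.uniformOfFintype Bool).map fun b => ⟨k, Function.update σ r (b :: σ r)⟩
  | ⟨.seq p q :: k, σ⟩ => PMF.pure ⟨p :: q :: k, σ⟩
  | ⟨.branch r pT pF pE :: k, σ⟩ =>
      match σ r with
      | [] => PMF.pure ⟨pE :: k, σ⟩
      | true :: _ => PMF.pure ⟨pT :: k, σ⟩
      | false :: _ => PMF.pure ⟨pF :: k, σ⟩
  | ⟨.loop r p :: k, σ⟩ =>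
      match σ r with
      | [] => PMF.pure ⟨k, σ⟩
      | _ :: _ => PMF.pure ⟨p :: .loop r p :: k, σ⟩

/-- The distribution of the configuration after `t` steps. -/
noncomputable def runFor : ℕ → Config → PMF Config
  | 0, c => PMF.pure c
  | t + 1, c => (step c).bind (runFor t)

/-- The initial configuration: the input is on stack `0` and all other stacks are empty. -/
def initial (p : Prog) (w : List Bool) : Config :=
  ⟨[p], fun r => if r = 0 then w else []⟩

/-- `p` halts on input `w` within `t` steps, whatever the outcomes of its coin tosses. -/
def HaltsWithin (p : Prog) (w : List Bool) (t : ℕ) : Prop :=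
  ∀ c ∈ (runFor t (initial p w)).support, c.todo = []

/-- A configuration accepts if it is halted with the bit `true` on top of stack `1`. -/
def Config.accepts (c : Config) : Bool :=
  c.todo.isEmpty && (c.store 1).head? == some true

/-- The probability that `p`, run on input `w`, has halted and accepted after `t` steps. -/
noncomputable def acceptProb (p : Prog) (w : List Bool) (t : ℕ) : ENNReal :=
  ((runFor t (initial p w)).map Config.accepts) true

/-! ### Randomized algorithms without false positives -/

/-- `p` is a randomized algorithm without false positives for MAX 3SAT`(c, s)` on formulas with `n`
variables and at most `ρ * n` clauses, and takes at most `T n` steps on each of them, for all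
outcomes of the coin tosses: YES instances are accepted with probability at least `1 / 2`, and NO
instances are never accepted. -/
def SolvesWithin (p : Prog) (c s : ℝ) (ρ : ℕ) (T : ℕ → ℝ) : Prop :=
  ∀ (n : ℕ) (φ : Formula n), φ.length ≤ ρ * n →
    ∃ t : ℕ, (t : ℝ) ≤ T n ∧ HaltsWithin p (encode φ) t ∧
      (IsYes c φ → 1 / 2 ≤ acceptProb p (encode φ) t) ∧
      (IsNo s φ → acceptProb p (encode φ) t = 0)

/-- MAX 3SAT`(c, s)` on formulas with `n` variables and `O(n)` clauses is solved in time
`2 ^ o(n)` by randomized algorithms without false positives: whatever the constant that bounds the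
ratio of clauses to variables, for every `δ > 0` there is such an algorithm that runs in time
`O(2 ^ (δ n))`. -/
def HasSubexpAlgorithm (c s : ℝ) : Prop :=
  ∀ (ρ : ℕ) (δ : ℝ), 0 < δ →
    ∃ (p : Prog) (C : ℝ), SolvesWithin p c s ρ fun n => C * (2 : ℝ) ^ (δ * (n : ℝ))

end MaxSat

namespace MaxSat

open scoped ENNReal

/-! ### The probability of halting with a given property -/

/-! One implication is a specialization: with soundness `max (1 - γ) (1 / 2)` and the `ε` that turns
`s * (1 + ε)` into `1`, an algorithm for imperfect completeness is one for perfect completeness.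

For the other implication, let `c` be the completeness, fix a rational `P / Q` strictly between `s`
and `c`, and cut the `m ≤ ρ n` clauses into groups of `k = 2 ^ b - 1`. For each group, guess how
many of its clauses are satisfied. A guess takes `b` bits per group, about `b m / k` bits in all.
Since `b / 2 ^ b` tends to `0`, a large constant `b` makes this at most `δ n / 4 + b`, so all
guesses can be tried (`exists_blockLength`). Only guesses with total at least `(P / Q) m` matter.
For such a guess, each group receives a 3-CNF gadget of constant size, on its own auxiliary
variables, which asserts that at least the guessed number of its clauses holds.

If an assignment satisfies a `c` fraction, its true counts form an admissible guess whose gadget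
formula is satisfiable (`isYes_of_satCounts`). If every assignment satisfies at most an `s`
fraction, then for every admissible guess each assignment falls short of the thresholds by at least
`(P / Q - s) m` in total. A group falls short by at most `k`, so linearly many groups contain a
violated gadget clause, and the gadget formula has a constant gap (`sum_le_countP_add`,
`isNo_of_thresholds`). The perfect-completeness algorithm applies, as the gadget formula has linear
size.

The absence of false positives is what makes the union over exponentially many guesses harmless: on
NO instances no run ever accepts, and on YES instances one good guess already gives probability `1 /
2`.

The remaining work is the realization on the machine model: a logic of lower bounds for halting
probabilities (`Reaches`, resting on `mul_le_haltProb_append`), the execution of an unknown program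
beside stacks that are in use (`Reaches.mergeStore`), writing the gadget formula
(`exists_runs_build`), the loop over the guesses (`reaches_loop_of_advances`,
`reaches_loop_of_advances_at`), their assembly (`exists_reaches_withGuesses`) and the running time
(`exists_time_bound`). -/

/-- The probability that the configuration `c` has halted after `t` steps, with stack contents that
satisfy `S`. -/
noncomputable def haltProb (t : ℕ) (c : Config) (S : Store → Prop) : ℝ≥0∞ :=
  (runFor t c).toOuterMeasure {c' | c'.todo = [] ∧ S c'.store}

lemma haltProb_zero_of_halted {σ : Store} {S : Store → Prop} (h : S σ) :
    haltProb 0 ⟨[], σ⟩ S = 1 := by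
  simp [haltProb, runFor, h]

lemma haltProb_zero_of_not {c : Config} {S : Store → Prop} (h : ¬ (c.todo = [] ∧ S c.store)) :
    haltProb 0 c S = 0 := by
  rw [haltProb, runFor, PMF.toOuterMeasure_pure_apply]
  exact if_neg h

lemma haltProb_succ (t : ℕ) (c : Config) (S : Store → Prop) :
    haltProb (t + 1) c S = ∑' c', step c c' * haltProb t c' S := by
  simp [haltProb, runFor, PMF.toOuterMeasure_bind_apply]

lemma haltProb_succ_of_step {t : ℕ} {c c' : Config} {S : Store → Prop}
    (h : step c = PMF.pure c') : haltProb (t + 1) c S = haltProb t c' S := by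
  simp [haltProb, runFor, h]

lemma haltProb_succ_le_of_forall {t u : ℕ} {c : Config} {S S' : Store → Prop}
    (h : ∀ c', haltProb t c' S ≤ haltProb u c' S') :
    haltProb (t + 1) c S ≤ haltProb (u + 1) c S' := by
  rw [haltProb_succ, haltProb_succ]
  gcongr
  exact h _

lemma haltProb_le_one (t : ℕ) (c : Config) (S : Store → Prop) : haltProb t c S ≤ 1 := by
  have h := (runFor t c).toOuterMeasure_mono (s := {c' | c'.todo = [] ∧ S c'.store})
    (t := Set.univ) (by simp)
  rwa [((runFor t c).toOuterMeasure_apply_eq_one_iff (s := Set.univ)).2 (Set.subset_univ _)] at h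

lemma haltProb_nil {t : ℕ} {σ : Store} {S : Store → Prop} :
    haltProb t ⟨[], σ⟩ S = haltProb 0 ⟨[], σ⟩ S := by
  induction t with
  | zero => rfl
  | succ t ih => rw [haltProb_succ_of_step (c' := ⟨[], σ⟩) (by simp [step]), ih]

lemma haltProb_le_succ (t : ℕ) (c : Config) (S : Store → Prop) :
    haltProb t c S ≤ haltProb (t + 1) c S := by
  induction t generalizing c with
  | zero =>
    by_cases h : c.todo = [] ∧ S c.store
    · obtain ⟨l, σ⟩ := c
      obtain ⟨rfl, h⟩ := h
      exact (haltProb_nil (t := 1)).ge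
    · simp [haltProb_zero_of_not h]
  | succ t ih => exact haltProb_succ_le_of_forall ih

lemma haltProb_mono_time {t u : ℕ} (h : t ≤ u) (c : Config) (S : Store → Prop) :
    haltProb t c S ≤ haltProb u c S := by
  induction h with
  | refl => rfl
  | step _ ih => exact ih.trans (haltProb_le_succ _ _ _)

lemma haltProb_mono {t : ℕ} {c : Config} {S S' : Store → Prop}
    (h : ∀ c' ∈ (runFor t c).support, S c'.store → S' c'.store) :
    haltProb t c S ≤ haltProb t c S' := by
  refine (runFor t c).toOuterMeasure_mono ?_
  rintro c' ⟨⟨h1, h2⟩, h3⟩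
  exact ⟨h1, h c' h3 h2⟩

lemma one_le_haltProb_iff {t : ℕ} {c : Config} {S : Store → Prop} :
    1 ≤ haltProb t c S ↔ ∀ c' ∈ (runFor t c).support, c'.todo = [] ∧ S c'.store := by
  rw [(haltProb_le_one t c S).ge_iff_eq, haltProb, PMF.toOuterMeasure_apply_eq_one_iff]
  rfl

/-- Appending a continuation does not change a computation before it halts. -/
lemma step_append {c : Config} (h : c.todo ≠ []) (k : List Prog) :
    step ⟨c.todo ++ k, c.store⟩ = (step c).map fun c' => ⟨c'.todo ++ k, c'.store⟩ := by
  obtain ⟨_ | ⟨p, l⟩, σ⟩ := c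
  · exact absurd rfl h
  · cases p with
    | branch r pT pF pE =>
      rcases hr : σ r with _ | ⟨_ | _, _⟩ <;> simp [step, hr, PMF.pure_map]
    | loop r p =>
      rcases hr : σ r with _ | ⟨b, _⟩ <;> simp [step, hr, PMF.pure_map]
    | toss r => simp [step, PMF.map_comp, Function.comp_def]
    | _ => simp [step, PMF.pure_map]

lemma tsum_map_mul {α β : Type*} (p : PMF α) (f : α → β) (g : β → ℝ≥0∞) :
    ∑' b, p.map f b * g b = ∑' a, p a * g (f a) := by
  classical
  simp only [PMF.map_apply, ← ENNReal.tsum_mul_right]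
  rw [ENNReal.tsum_comm]
  refine tsum_congr fun a => ?_
  rw [tsum_eq_single (f a)]
  · simp
  · intro b hb
    simp [hb]

/-- This is the Markov property as a lower bound: condition on the first step and induct on `t`. A
first part that halts early leaves unused steps, which monotonicity in time absorbs. Sequencing and
loops both reduce to this estimate. -/
lemma mul_le_haltProb_append {S S' : Store → Prop} {k : List Prog} {u : ℕ} {q : ℝ≥0∞}
    (h : ∀ σ, S σ → q ≤ haltProb u ⟨k, σ⟩ S') (t : ℕ) (c : Config) :
    haltProb t c S * q ≤ haltProb (t + u) ⟨c.todo ++ k, c.store⟩ S' := by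
  induction t generalizing c with
  | zero =>
    by_cases hc : c.todo = [] ∧ S c.store
    · obtain ⟨l, σ⟩ := c
      obtain ⟨rfl, hS⟩ := hc
      rw [haltProb_zero_of_halted hS, one_mul, Nat.zero_add]
      exact h σ hS
    · simp [haltProb_zero_of_not hc]
  | succ t ih =>
    by_cases hc : c.todo = []
    · obtain ⟨l, σ⟩ := c
      obtain rfl : l = [] := hc
      rw [haltProb_nil]
      by_cases hS : S σ
      · rw [haltProb_zero_of_halted hS, one_mul]
        exact (h σ hS).trans (haltProb_mono_time (by omega) _ _)
      · simp [haltProb_zero_of_not (c := ⟨[], σ⟩) (S := S) (by simp [hS])]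
    · rw [show t + 1 + u = t + u + 1 by omega, haltProb_succ, haltProb_succ, step_append hc,
        tsum_map_mul, ← ENNReal.tsum_mul_right]
      refine ENNReal.tsum_le_tsum fun c' => ?_
      rw [mul_assoc]
      gcongr
      exact ih c'

/-! ### A program logic -/

/-- Started with the stack contents `σ`, the program `p` halts within `t` steps with stack contents
that satisfy `S`, with probability at least `q`. -/
def Reaches (q : ℝ≥0∞) (p : Prog) (σ : Store) (t : ℕ) (S : Store → Prop) : Prop :=
  q ≤ haltProb t ⟨[p], σ⟩ S

/-- Started with the stack contents `σ`, the program `p` halts within `t` steps with the stack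
contents `σ'`. -/
def Runs (p : Prog) (σ : Store) (t : ℕ) (σ' : Store) : Prop := Reaches 1 p σ t (· = σ')

lemma Reaches.mono {q q' : ℝ≥0∞} {p : Prog} {σ : Store} {t t' : ℕ} {S S' : Store → Prop}
    (h : Reaches q p σ t S) (hq : q' ≤ q) (ht : t ≤ t') (hS : ∀ σ', S σ' → S' σ') :
    Reaches q' p σ t' S' :=
  hq.trans (h.trans ((haltProb_mono_time ht _ _).trans (haltProb_mono fun c' _ => hS c'.store)))

lemma Runs.mono {p : Prog} {σ σ' : Store} {t t' : ℕ} (h : Runs p σ t σ') (ht : t ≤ t') :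
    Runs p σ t' σ' :=
  Reaches.mono h le_rfl ht fun _ => id

lemma Runs.reaches {p : Prog} {σ σ' : Store} {t : ℕ} {S : Store → Prop}
    (h : Runs p σ t σ') (hS : S σ') : Reaches 1 p σ t S :=
  Reaches.mono h le_rfl le_rfl (by rintro _ rfl; exact hS)

lemma Reaches.seq {q q' : ℝ≥0∞} {p p' : Prog} {σ : Store} {t u : ℕ} {S S' : Store → Prop}
    (h : Reaches q p σ t S) (h' : ∀ σ', S σ' → Reaches q' p' σ' u S') :
    Reaches (q * q') (.seq p p') σ (t + u + 1) S' := by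
  rw [Reaches, haltProb_succ_of_step (c' := ⟨[p, p'], σ⟩) (by simp [step])]
  exact (mul_le_mul_left h q').trans (mul_le_haltProb_append h' t ⟨[p], σ⟩)

lemma Runs.seq_reaches {q : ℝ≥0∞} {p p' : Prog} {σ σ' : Store} {t u : ℕ} {S : Store → Prop}
    (h : Runs p σ t σ') (h' : Reaches q p' σ' u S) : Reaches q (.seq p p') σ (t + u + 1) S := by
  simpa using Reaches.seq h (q' := q) (by rintro _ rfl; exact h')

lemma Runs.seq {p p' : Prog} {σ σ' σ'' : Store} {t u : ℕ}
    (h : Runs p σ t σ') (h' : Runs p' σ' u σ'') : Runs (.seq p p') σ (t + u + 1) σ'' :=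
  h.seq_reaches h'

lemma Runs.of_step {p : Prog} {σ σ' : Store} (h : step ⟨[p], σ⟩ = PMF.pure ⟨[], σ'⟩) :
    Runs p σ 1 σ' := by
  rw [Runs, Reaches, haltProb_succ_of_step h]
  exact (haltProb_zero_of_halted (S := (· = σ')) rfl).ge

lemma runs_nop (σ : Store) : Runs .nop σ 1 σ := .of_step (by simp [step])

lemma runs_push (r : ℕ) (b : Bool) (σ : Store) :
    Runs (.push r b) σ 1 (Function.update σ r (b :: σ r)) := .of_step (by simp [step])

lemma runs_pop (r : ℕ) (σ : Store) :
    Runs (.pop r) σ 1 (Function.update σ r (σ r).tail) := .of_step (by simp [step])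

lemma reaches_branch_nil {q : ℝ≥0∞} {r : ℕ} {pT pF pE : Prog} {σ : Store} {t : ℕ}
    {S : Store → Prop} (hr : σ r = []) (h : Reaches q pE σ t S) :
    Reaches q (.branch r pT pF pE) σ (t + 1) S := by
  rwa [Reaches, haltProb_succ_of_step (c' := ⟨[pE], σ⟩) (by simp [step, hr])]

lemma reaches_branch_true {q : ℝ≥0∞} {r : ℕ} {pT pF pE : Prog} {σ : Store} {t : ℕ}
    {S : Store → Prop} {w : List Bool} (hr : σ r = true :: w) (h : Reaches q pT σ t S) :
    Reaches q (.branch r pT pF pE) σ (t + 1) S := by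
  rwa [Reaches, haltProb_succ_of_step (c' := ⟨[pT], σ⟩) (by simp [step, hr])]

lemma reaches_branch_false {q : ℝ≥0∞} {r : ℕ} {pT pF pE : Prog} {σ : Store} {t : ℕ}
    {S : Store → Prop} {w : List Bool} (hr : σ r = false :: w) (h : Reaches q pF σ t S) :
    Reaches q (.branch r pT pF pE) σ (t + 1) S := by
  rwa [Reaches, haltProb_succ_of_step (c' := ⟨[pF], σ⟩) (by simp [step, hr])]

lemma runs_loop_nil {r : ℕ} {p : Prog} {σ : Store} (hr : σ r = []) : Runs (.loop r p) σ 1 σ :=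
  .of_step (by simp [step, hr])

lemma Reaches.loop {q q' : ℝ≥0∞} {r : ℕ} {p : Prog} {σ : Store} {t u : ℕ} {S S' : Store → Prop}
    (hr : σ r ≠ []) (h : Reaches q p σ t S)
    (h' : ∀ σ', S σ' → Reaches q' (.loop r p) σ' u S') :
    Reaches (q * q') (.loop r p) σ (t + u + 1) S' := by
  obtain ⟨b, w, hr⟩ := List.exists_cons_of_ne_nil hr
  rw [Reaches, haltProb_succ_of_step (c' := ⟨[p, .loop r p], σ⟩) (by simp [step, hr])]
  exact (mul_le_mul_left h q').trans (mul_le_haltProb_append h' t ⟨[p], σ⟩)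

lemma Runs.loop {r : ℕ} {p : Prog} {σ σ' σ'' : Store} {t u : ℕ} (hr : σ r ≠ [])
    (h : Runs p σ t σ') (h' : Runs (.loop r p) σ' u σ'') :
    Runs (.loop r p) σ (t + u + 1) σ'' := by
  rw [Runs, ← one_mul (1 : ℝ≥0∞)]
  exact Reaches.loop hr h (q' := 1) (S' := (· = σ'')) (by rintro _ rfl; exact h')

/-! ### Programs that use few stacks -/

/-- All stacks that the program mentions are among the first `B`. -/
def Prog.Below (B : ℕ) : Prog → Prop
  | .nop => True
  | .push r _ | .pop r | .toss r => r < B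
  | .seq p q => p.Below B ∧ q.Below B
  | .branch r pT pF pE => r < B ∧ pT.Below B ∧ pF.Below B ∧ pE.Below B
  | .loop r p => r < B ∧ p.Below B

lemma Prog.Below.mono {B B' : ℕ} (h : B ≤ B') {p : Prog} (hp : p.Below B) : p.Below B' := by
  induction p with
  | nop => trivial
  | push r b => exact lt_of_lt_of_le hp h
  | pop r => exact lt_of_lt_of_le hp h
  | toss r => exact lt_of_lt_of_le hp h
  | seq p q ihp ihq => exact ⟨ihp hp.1, ihq hp.2⟩
  | branch r pT pF pE ihT ihF ihE =>
    exact ⟨lt_of_lt_of_le hp.1 h, ihT hp.2.1, ihF hp.2.2.1, ihE hp.2.2.2⟩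
  | loop r p ih => exact ⟨lt_of_lt_of_le hp.1 h, ih hp.2⟩

lemma Prog.exists_below (p : Prog) : ∃ B, p.Below B := by
  induction p with
  | nop => exact ⟨0, trivial⟩
  | push r b => exact ⟨r + 1, Nat.lt_succ_self r⟩
  | pop r => exact ⟨r + 1, Nat.lt_succ_self r⟩
  | toss r => exact ⟨r + 1, Nat.lt_succ_self r⟩
  | seq p q ihp ihq =>
    obtain ⟨a, ha⟩ := ihp
    obtain ⟨b, hb⟩ := ihq
    exact ⟨a + b, ha.mono (by omega), hb.mono (by omega)⟩
  | branch r pT pF pE ihT ihF ihE =>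
    obtain ⟨a, ha⟩ := ihT
    obtain ⟨b, hb⟩ := ihF
    obtain ⟨c, hc⟩ := ihE
    exact ⟨a + b + c + r + 1, by omega, ha.mono (by omega), hb.mono (by omega),
      hc.mono (by omega)⟩
  | loop r p ih =>
    obtain ⟨a, ha⟩ := ih
    exact ⟨a + r + 1, by omega, ha.mono (by omega)⟩

/-- The store with the first `B` stacks of `σ` and the other stacks of `τ`. -/
def mergeStore (B : ℕ) (τ σ : Store) : Store := fun r => if r < B then σ r else τ r

lemma mergeStore_of_lt {B r : ℕ} (τ σ : Store) (h : r < B) : mergeStore B τ σ r = σ r := if_pos h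

lemma mergeStore_of_le {B r : ℕ} (τ σ : Store) (h : B ≤ r) : mergeStore B τ σ r = τ r :=
  if_neg (by omega)

lemma mergeStore_update {B r : ℕ} (τ σ : Store) (h : r < B) (w : List Bool) :
    mergeStore B τ (Function.update σ r w) = Function.update (mergeStore B τ σ) r w := by
  funext i
  by_cases hi : i = r
  · subst hi
    simp [mergeStore, h]
  · simp [mergeStore, hi]

/-- A step reads and changes only the stack that its program mentions, so overwriting the stacks
from `B` on commutes with it. -/
lemma step_mergeStore {B : ℕ} (τ : Store) {c : Config} (h : ∀ p ∈ c.todo, p.Below B) :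
    step ⟨c.todo, mergeStore B τ c.store⟩ =
      (step c).map fun c' => ⟨c'.todo, mergeStore B τ c'.store⟩ := by
  obtain ⟨_ | ⟨p, l⟩, σ⟩ := c
  · simp [step, PMF.pure_map]
  · have hp : p.Below B := h p (by simp)
    cases p with
    | nop => simp [step, PMF.pure_map]
    | push r b =>
      simp only [step, PMF.pure_map, mergeStore_update τ σ hp, mergeStore_of_lt τ σ hp]
    | pop r =>
      simp only [step, PMF.pure_map, mergeStore_update τ σ hp, mergeStore_of_lt τ σ hp]
    | toss r =>
      simp only [step, PMF.map_comp, Function.comp_def, mergeStore_update τ σ hp,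
        mergeStore_of_lt τ σ hp]
    | seq p q => simp [step, PMF.pure_map]
    | branch r pT pF pE =>
      have hr := mergeStore_of_lt τ σ hp.1
      rcases hr' : σ r with _ | ⟨_ | _, _⟩ <;> simp [step, hr, hr', PMF.pure_map]
    | loop r p =>
      have hr := mergeStore_of_lt τ σ hp.1
      rcases hr' : σ r with _ | ⟨b, _⟩ <;> simp [step, hr, hr', PMF.pure_map]

lemma below_of_mem_support_step {B : ℕ} {c c' : Config} (h : ∀ p ∈ c.todo, p.Below B)
    (hc' : c' ∈ (step c).support) : ∀ p ∈ c'.todo, p.Below B := by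
  obtain ⟨_ | ⟨p, l⟩, σ⟩ := c
  · simp only [step, PMF.support_pure, Set.mem_singleton_iff] at hc'
    subst hc'
    exact h
  · have hl : ∀ q ∈ l, q.Below B := fun q hq => h q (List.mem_cons_of_mem p hq)
    have hp : p.Below B := h p (by simp)
    cases p with
    | toss r =>
      simp only [step, PMF.mem_support_map_iff] at hc'
      obtain ⟨b, -, rfl⟩ := hc'
      exact hl
    | branch r pT pF pE =>
      obtain ⟨-, hT, hF, hE⟩ := hp
      rcases hr : σ r with _ | ⟨_ | _, _⟩ <;>
        simp only [step, hr, PMF.support_pure, Set.mem_singleton_iff] at hc' <;>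
        subst hc' <;> simp_all
    | loop r p =>
      have h' := hp.2
      rcases hr : σ r with _ | ⟨b, _⟩ <;>
        simp only [step, hr, PMF.support_pure, Set.mem_singleton_iff] at hc' <;>
        subst hc' <;> simp_all
    | seq p q =>
      obtain ⟨h1, h2⟩ := hp
      simp only [step, PMF.support_pure, Set.mem_singleton_iff] at hc'
      subst hc'
      simp_all
    | _ =>
      simp only [step, PMF.support_pure, Set.mem_singleton_iff] at hc'
      subst hc'
      exact hl

lemma haltProb_mergeStore {B : ℕ} (τ : Store) (S : Store → Prop) (t : ℕ) (c : Config)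
    (h : ∀ p ∈ c.todo, p.Below B) :
    haltProb t ⟨c.todo, mergeStore B τ c.store⟩ S =
      haltProb t c fun σ => S (mergeStore B τ σ) := by
  induction t generalizing c with
  | zero => simp [haltProb, runFor, PMF.toOuterMeasure_pure_apply]
  | succ t ih =>
    rw [haltProb_succ, haltProb_succ, step_mergeStore τ h, tsum_map_mul]
    refine tsum_congr fun c' => ?_
    -- The induction hypothesis needs the remaining programs to stay below `B`, which is known only
    -- on the support; elsewhere the weight is zero.
    by_cases hc' : c' ∈ (step c).support
    · rw [ih c' (below_of_mem_support_step h hc')]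
    · rw [(step c).apply_eq_zero_iff c' |>.2 hc', zero_mul, zero_mul]

/-! ### How much a computation can write -/

/-- The number of bits on the first `B` stacks. -/
def lowSize (B : ℕ) (σ : Store) : ℕ := ∑ r ∈ Finset.range B, (σ r).length

lemma lowSize_update_le (B : ℕ) (σ : Store) (r : ℕ) {w : List Bool}
    (hw : w.length ≤ (σ r).length + 1) : lowSize B (Function.update σ r w) ≤ lowSize B σ + 1 := by
  classical
  have h : ∀ i ∈ Finset.range B, (Function.update σ r w i).length ≤
      (σ i).length + if i = r then 1 else 0 := by
    intro i _
    by_cases hi : i = r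
    · subst hi
      simpa using hw
    · simp [hi]
  refine (Finset.sum_le_sum h).trans ?_
  rw [Finset.sum_add_distrib, Finset.sum_ite_eq']
  unfold lowSize
  split_ifs <;> omega

lemma lowSize_le_of_mem_support_step (B : ℕ) {c c' : Config} (h : c' ∈ (step c).support) :
    lowSize B c'.store ≤ lowSize B c.store + 1 := by
  obtain ⟨_ | ⟨p, l⟩, σ⟩ := c
  · simp only [step, PMF.support_pure, Set.mem_singleton_iff] at h
    subst h
    omega
  · cases p with
    | toss r =>
      simp only [step, PMF.mem_support_map_iff] at h
      obtain ⟨b, -, rfl⟩ := h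
      exact lowSize_update_le B σ r (by simp)
    | push r b =>
      simp only [step, PMF.support_pure, Set.mem_singleton_iff] at h
      subst h
      exact lowSize_update_le B σ r (by simp)
    | pop r =>
      simp only [step, PMF.support_pure, Set.mem_singleton_iff] at h
      subst h
      exact lowSize_update_le B σ r (by simp; omega)
    | branch r pT pF pE =>
      rcases hr : σ r with _ | ⟨_ | _, _⟩ <;>
        simp only [step, hr, PMF.support_pure, Set.mem_singleton_iff] at h <;> subst h <;> simp
    | loop r p =>
      rcases hr : σ r with _ | ⟨b, _⟩ <;>
        simp only [step, hr, PMF.support_pure, Set.mem_singleton_iff] at h <;> subst h <;> simp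
    | _ =>
      simp only [step, PMF.support_pure, Set.mem_singleton_iff] at h
      subst h
      simp

/-- A step adds at most one bit. This bounds the cost of erasing what a subroutine leaves behind. -/
lemma lowSize_le_of_mem_support_runFor (B : ℕ) (t : ℕ) {c c' : Config}
    (h : c' ∈ (runFor t c).support) : lowSize B c'.store ≤ lowSize B c.store + t := by
  induction t generalizing c with
  | zero =>
    simp only [runFor, PMF.support_pure, Set.mem_singleton_iff] at h
    subst h
    omega
  | succ t ih =>
    simp only [runFor, PMF.mem_support_bind_iff] at h
    obtain ⟨d, hd, h⟩ := h
    have h1 := ih h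
    have h2 := lowSize_le_of_mem_support_step B hd
    omega

/-! ### Running an algorithm as a subroutine -/

/-- The event that the halted computation has accepted. -/
def Accepting (σ : Store) : Prop := (σ 1).head? = some true

/-- The initial stack contents on input `w`. -/
def inputStore (w : List Bool) : Store := fun r => if r = 0 then w else []

lemma lowSize_inputStore (B : ℕ) (w : List Bool) : lowSize B (inputStore w) ≤ w.length := by
  classical
  have h : ∀ i ∈ Finset.range B, (inputStore w i).length ≤ if i = 0 then w.length else 0 := by
    intro i _
    unfold inputStore
    split_ifs <;> simp
  refine (Finset.sum_le_sum h).trans ?_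
  rw [Finset.sum_ite_eq']
  split_ifs <;> omega

lemma haltsWithin_iff {p : Prog} {w : List Bool} {t : ℕ} :
    HaltsWithin p w t ↔ Reaches 1 p (inputStore w) t fun _ => True := by
  rw [Reaches, one_le_haltProb_iff]
  simp only [and_true]
  rfl

lemma accepts_iff (c : Config) : c.accepts = true ↔ c.todo = [] ∧ Accepting c.store := by
  simp [Config.accepts, Accepting]

lemma acceptProb_eq {p : Prog} {w : List Bool} {t : ℕ} :
    acceptProb p w t = haltProb t ⟨[p], inputStore w⟩ Accepting := by
  rw [acceptProb, ← PMF.toOuterMeasure_apply_singleton, PMF.toOuterMeasure_map_apply, haltProb]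
  congr 1
  ext c
  simp [accepts_iff]

/-- For a program that always halts, never accepting means halting in rejection with probability
one. Soundness thereby also becomes a lower bound on a probability, the only kind of statement that
`Reaches` composes. -/
lemma acceptProb_eq_zero_iff {p : Prog} {w : List Bool} {t : ℕ} (h : HaltsWithin p w t) :
    acceptProb p w t = 0 ↔ Reaches 1 p (inputStore w) t fun σ => ¬ Accepting σ := by
  rw [acceptProb_eq, Reaches, one_le_haltProb_iff, haltProb, PMF.toOuterMeasure_apply_eq_zero_iff,
    Set.disjoint_left]
  refine forall₂_congr fun c hc => ?_
  have : c.todo = [] := h c hc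
  simp [this]

/-- A program that only uses the first `B` stacks can be run while the other stacks are in use. -/
lemma Reaches.mergeStore {B : ℕ} {p : Prog} (hp : p.Below B) {q : ℝ≥0∞} {w : List Bool} {t : ℕ}
    {S : Store → Prop} (h : Reaches q p (inputStore w) t S) (τ : Store) :
    Reaches q p (MaxSat.mergeStore B τ (inputStore w)) t fun σ' =>
      ∃ σ, σ' = MaxSat.mergeStore B τ σ ∧ S σ ∧ lowSize B σ ≤ w.length + t := by
  have := haltProb_mergeStore (B := B) τ (fun σ' => ∃ σ, σ' = MaxSat.mergeStore B τ σ ∧ S σ ∧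
    lowSize B σ ≤ w.length + t) t ⟨[p], inputStore w⟩ (by simpa using hp)
  rw [Reaches, this]
  refine h.trans (haltProb_mono fun c' hc' hS => ⟨c'.store, rfl, hS, ?_⟩)
  exact (lowSize_le_of_mem_support_runFor B t hc').trans
    (Nat.add_le_add_right (lowSize_inputStore B w) t)

/-! ### Subroutines -/

lemma Runs.congr {p : Prog} {σ σ' σ'' : Store} {t t' : ℕ} (h : Runs p σ t σ') (ht : t ≤ t')
    (hσ : σ' = σ'') : Runs p σ t' σ'' :=
  hσ ▸ h.mono ht

lemma Runs.branch_true {r : ℕ} {pT pF pE : Prog} {σ σ' : Store} {t : ℕ} {w : List Bool}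
    (hr : σ r = true :: w) (h : Runs pT σ t σ') : Runs (.branch r pT pF pE) σ (t + 1) σ' :=
  reaches_branch_true hr h

lemma Runs.branch_false {r : ℕ} {pT pF pE : Prog} {σ σ' : Store} {t : ℕ} {w : List Bool}
    (hr : σ r = false :: w) (h : Runs pF σ t σ') : Runs (.branch r pT pF pE) σ (t + 1) σ' :=
  reaches_branch_false hr h

lemma Runs.branch_nil {r : ℕ} {pT pF pE : Prog} {σ σ' : Store} {t : ℕ}
    (hr : σ r = []) (h : Runs pE σ t σ') : Runs (.branch r pT pF pE) σ (t + 1) σ' :=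
  reaches_branch_nil hr h

/-- Run `p` exactly `n` times. -/
def Prog.rep (p : Prog) : ℕ → Prog
  | 0 => .nop
  | n + 1 => .seq p (p.rep n)

lemma runs_rep_push (r : ℕ) (b : Bool) (n : ℕ) (σ : Store) :
    Runs ((Prog.push r b).rep n) σ (2 * n + 1)
      (Function.update σ r (List.replicate n b ++ σ r)) := by
  induction n generalizing σ with
  | zero => exact (runs_nop σ).congr (by omega) (by simp)
  | succ n ih =>
    refine ((runs_push r b σ).seq (ih _)).congr (by omega) ?_
    simp [List.replicate_succ']

lemma runs_rep_pop (r : ℕ) (n : ℕ) (σ : Store) :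
    Runs ((Prog.pop r).rep n) σ (2 * n + 1) (Function.update σ r ((σ r).drop n)) := by
  induction n generalizing σ with
  | zero => exact (runs_nop σ).congr (by omega) (by simp)
  | succ n ih =>
    refine ((runs_pop r σ).seq (ih _)).congr (by omega) ?_
    simp

lemma update_nil_eq_self {σ : Store} {a : ℕ} (h : σ a = []) : Function.update σ a [] = σ := by
  rw [← h, Function.update_eq_self]

/-- Move the contents of stack `a` to stack `b`, which reverses their order. -/
def Prog.move (a b : ℕ) : Prog :=
  .loop a (.branch a (.seq (.push b true) (.pop a)) (.seq (.push b false) (.pop a)) .nop)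

lemma runs_move {a b : ℕ} (hab : a ≠ b) {w : List Bool} {σ : Store} (hw : σ a = w) :
    Runs (.move a b) σ (5 * w.length + 1)
      (Function.update (Function.update σ a []) b (w.reverse ++ σ b)) := by
  induction w generalizing σ with
  | nil => exact (runs_loop_nil hw).congr (by simp) (by simp [update_nil_eq_self hw])
  | cons x w ih =>
    have hbody : Runs (.branch a (.seq (.push b true) (.pop a)) (.seq (.push b false) (.pop a))
        .nop) σ 4 (Function.update (Function.update σ b (x :: σ b)) a w) := by
      have h := (runs_push b x σ).seq (runs_pop a _)
      have h' := h.congr (t' := 3) (σ'' := Function.update (Function.update σ b (x :: σ b)) a w)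
        le_rfl (by simp [Function.update_of_ne hab, hw])
      cases x
      · exact .branch_false hw h'
      · exact .branch_true hw h'
    refine (Runs.loop (by simp [hw]) hbody (ih (by simp))).congr (by simp; omega) ?_
    funext i
    simp only [Function.update_apply]
    split_ifs <;> simp_all

/-- Push the contents of stack `a`, from the top down, on stack `b`; stack `c` is used for the
restoration of stack `a`. -/
def Prog.copy (a b c : ℕ) : Prog :=
  .seq (.loop a (.branch a (.seq (.push c true) (.seq (.push b true) (.pop a)))
    (.seq (.push c false) (.seq (.push b false) (.pop a))) .nop)) (.move c a)

/-- Both `b` and `c` receive the bits in reversed order. Moving `c` back reverses once more, so `a`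
is restored while the copy on `b` stays reversed. -/
lemma runs_copy {a b c : ℕ} (hab : a ≠ b) (hac : a ≠ c) (hbc : b ≠ c) {w : List Bool} {σ : Store}
    (hw : σ a = w) (hc : σ c = []) :
    Runs (.copy a b c) σ (12 * w.length + 3) (Function.update σ b (w.reverse ++ σ b)) := by
  have hdup : ∀ (w : List Bool) (σ : Store), σ a = w →
      Runs (.loop a (.branch a (.seq (.push c true) (.seq (.push b true) (.pop a)))
        (.seq (.push c false) (.seq (.push b false) (.pop a))) .nop)) σ (7 * w.length + 1)
      (Function.update (Function.update (Function.update σ a []) b (w.reverse ++ σ b)) c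
        (w.reverse ++ σ c)) := by
    intro w
    induction w with
    | nil =>
      intro σ hw
      exact (runs_loop_nil hw).congr (by simp) (by simp [update_nil_eq_self hw])
    | cons x w ih =>
      intro σ hw
      have h := (runs_push c x σ).seq ((runs_push b x _).seq (runs_pop a _))
      have h' := h.congr (t' := 5) (σ'' := Function.update (Function.update
        (Function.update σ b (x :: σ b)) c (x :: σ c)) a w) le_rfl (by
          funext i
          simp only [Function.update_apply]
          split_ifs <;> simp_all)
      have hbody : Runs (.branch a (.seq (.push c true) (.seq (.push b true) (.pop a)))
          (.seq (.push c false) (.seq (.push b false) (.pop a))) .nop) σ 6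
          (Function.update (Function.update (Function.update σ b (x :: σ b)) c (x :: σ c)) a w) := by
        cases x
        · exact .branch_false hw h'
        · exact .branch_true hw h'
      refine (Runs.loop (by simp [hw]) hbody (ih _ (by simp))).congr (by simp; omega) ?_
      funext i
      simp only [Function.update_apply]
      split_ifs <;> simp_all
  refine ((hdup w σ hw).seq (runs_move hac.symm (w := w.reverse) (by simp [hc]))).congr
    (by simp; omega) ?_
  funext i
  simp only [Function.update_apply]
  split_ifs <;> simp_all

/-- Remove a number in unary encoding from the top of stack `a`, and push as many ones on stack
`b`; stack `c` is used for control. -/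
def Prog.readNat (a b c : ℕ) : Prog :=
  .seq (.push c true) (.loop c (.branch a (.seq (.push b true) (.pop a)) (.seq (.pop a) (.pop c))
    (.pop c)))

lemma runs_readNat {a b c : ℕ} (hab : a ≠ b) (hac : a ≠ c) (hbc : b ≠ c) {i : ℕ} {w : List Bool}
    {σ : Store} (hw : σ a = encodeNat i ++ w) (hc : σ c = []) :
    Runs (.readNat a b c) σ (5 * i + 10)
      (Function.update (Function.update σ a w) b (List.replicate i true ++ σ b)) := by
  have hloop : ∀ (i : ℕ) (σ : Store), σ a = encodeNat i ++ w → σ c = [true] →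
      Runs (.loop c (.branch a (.seq (.push b true) (.pop a)) (.seq (.pop a) (.pop c))
        (.pop c))) σ (5 * i + 7)
      (Function.update (Function.update (Function.update σ a w) b
        (List.replicate i true ++ σ b)) c []) := by
    intro i
    induction i with
    | zero =>
      intro σ hw hc
      have h := Runs.branch_false (pT := .seq (.push b true) (.pop a)) (pE := .pop c)
        (show σ a = false :: w by simpa [encodeNat] using hw)
        ((runs_pop a σ).seq (runs_pop c _))
      refine (Runs.loop (by simp [hc]) h (runs_loop_nil ?_)).congr (by omega) ?_
      · simp [Function.update_of_ne hac.symm, hc]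
      · funext j
        simp only [Function.update_apply]
        split_ifs <;> simp_all [encodeNat]
    | succ i ih =>
      intro σ hw hc
      have hw' : σ a = true :: (encodeNat i ++ w) := by
        simpa [encodeNat, List.replicate_succ] using hw
      have h := Runs.branch_true (pF := .seq (.pop a) (.pop c)) (pE := .pop c) hw'
        ((runs_push b true σ).seq (runs_pop a _))
      refine (Runs.loop (by simp [hc]) h (ih _ ?_ ?_)).congr (by omega) ?_
      · simp [Function.update_of_ne hab, hw']
      · simp [Function.update_of_ne hac.symm, Function.update_of_ne hbc.symm, hc]
      · funext j
        simp only [Function.update_apply]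
        split_ifs <;> simp_all [List.replicate_succ']
  refine ((runs_push c true σ).seq (hloop i _ ?_ ?_)).congr (by omega) ?_
  · simp [Function.update_of_ne hac, hw]
  · simp [hc]
  · funext j
    simp only [Function.update_apply]
    split_ifs <;> simp_all

/-- Remove everything from stack `r`. -/
def Prog.clear (r : ℕ) : Prog := .loop r (.pop r)

lemma runs_clear (r : ℕ) (σ : Store) :
    Runs (.clear r) σ (2 * (σ r).length + 1) (Function.update σ r []) := by
  have h : ∀ (w : List Bool) (σ : Store), σ r = w →
      Runs (.clear r) σ (2 * w.length + 1) (Function.update σ r []) := by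
    intro w
    induction w with
    | nil =>
      intro σ hw
      exact (runs_loop_nil hw).congr (by simp) (by simp [← hw])
    | cons x w ih =>
      intro σ hw
      refine (Runs.loop (by simp [hw]) (runs_pop r σ) (ih _ (by simp [hw]))).congr
        (by simp; omega) (by simp)
  exact h _ σ rfl

/-- Remove everything from the first `B` stacks. -/
def Prog.clearBelow : ℕ → Prog
  | 0 => .nop
  | B + 1 => .seq (.clear B) (.clearBelow B)

lemma runs_clearBelow (B : ℕ) (σ : Store) :
    Runs (.clearBelow B) σ (2 * lowSize B σ + 2 * B + 1) (mergeStore B σ fun _ => []) := by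
  induction B generalizing σ with
  | zero => exact (runs_nop σ).congr (by omega) (by funext i; simp [mergeStore])
  | succ B ih =>
    have hsize : lowSize B (Function.update σ B []) = lowSize B σ := by
      refine Finset.sum_congr rfl fun i hi => ?_
      rw [Function.update_of_ne (Finset.mem_range.1 hi).ne]
    refine ((runs_clear B σ).seq (ih _)).congr ?_ ?_
    · rw [hsize, lowSize, lowSize, Finset.sum_range_succ]
      omega
    · funext i
      simp only [mergeStore, Function.update_apply]
      split_ifs <;> first | rfl | omega

/-! ### Counting in binary -/

/-- The number with the given binary digits, least significant digit first. -/
def binValue : List Bool → ℕ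
  | [] => 0
  | b :: w => b.toNat + 2 * binValue w

lemma binValue_lt (w : List Bool) : binValue w < 2 ^ w.length := by
  induction w with
  | nil => simp [binValue]
  | cons b w ih =>
    rw [binValue, List.length_cons, pow_succ]
    cases b <;> simp <;> omega

lemma exists_binValue_eq (l a : ℕ) (ha : a < 2 ^ l) :
    ∃ w : List Bool, w.length = l ∧ binValue w = a := by
  induction l generalizing a with
  | zero => exact ⟨[], rfl, by simp [binValue]; simp at ha; omega⟩
  | succ l ih =>
    obtain ⟨w, hw, hv⟩ := ih (a / 2) (by rw [pow_succ] at ha; omega)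
    refine ⟨decide (a % 2 = 1) :: w, by simp [hw], ?_⟩
    rw [binValue, hv]
    by_cases h : a % 2 = 1 <;> simp [h] <;> omega

lemma eq_of_binValue_eq {v w : List Bool} (hl : v.length = w.length)
    (h : binValue v = binValue w) : v = w := by
  induction v generalizing w with
  | nil => exact (List.length_eq_zero_iff.1 hl.symm).symm
  | cons b v ih =>
    obtain _ | ⟨c, w⟩ := w
    · simp at hl
    · simp only [binValue] at h
      have hbc : b = c := by cases b <;> cases c <;> simp at h ⊢ <;> omega
      subst hbc
      rw [ih (by simpa using hl) (by omega)]

lemma binValue_replicate_true (l : ℕ) : binValue (List.replicate l true) + 1 = 2 ^ l := by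
  induction l with
  | zero => simp [binValue]
  | succ l ih =>
    rw [List.replicate_succ, binValue, pow_succ]
    simp
    omega

lemma binValue_carry (j : ℕ) (w : List Bool) :
    binValue (List.replicate j false ++ true :: w) =
      binValue (List.replicate j true ++ false :: w) + 1 := by
  induction j with
  | zero => simp [binValue]; omega
  | succ j ih =>
    simp only [List.replicate_succ, List.cons_append, binValue, ih]
    simp
    omega

lemma eq_replicate_true_or_carry (w : List Bool) :
    w = List.replicate w.length true ∨
      ∃ j v, w = List.replicate j true ++ false :: v := by
  induction w with
  | nil => simp
  | cons b w ih =>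
    cases b
    · exact Or.inr ⟨0, w, by simp⟩
    · rcases ih with h | ⟨j, v, h⟩
      · left
        rw [List.length_cons, List.replicate_succ, ← h]
      · exact Or.inr ⟨j + 1, v, by simp [h, List.replicate_succ]⟩

/-- The carry loop of the incrementation. -/
def Prog.carry (a t c h : ℕ) : Prog :=
  .loop c (.branch a (.seq (.pop a) (.push t true)) (.seq (.pop a) (.seq (.push a true) (.pop c)))
    (.seq (.pop c) (.pop h)))

/-- Increment the number in binary on stack `a`. If it has overflown, pop stack `h`. -/
def Prog.increment (a t c h : ℕ) : Prog :=
  .seq (.push c true) (.seq (.carry a t c h) (.loop t (.seq (.pop t) (.push a false))))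

lemma runs_carry {a t c h : ℕ} (hat : a ≠ t) (hac : a ≠ c) (htc : t ≠ c)
    (j : ℕ) {v : List Bool} {σ : Store}
    (ha : σ a = List.replicate j true ++ false :: v) (hc : σ c = [true]) :
    Runs (.carry a t c h) σ (5 * j + 9)
      (Function.update (Function.update (Function.update σ a (true :: v)) t
        (List.replicate j true ++ σ t)) c []) := by
  induction j generalizing σ with
  | zero =>
    have hb := Runs.branch_false (pT := .seq (.pop a) (.push t true)) (pE := .seq (.pop c) (.pop h))
      (show σ a = false :: v by simpa using ha)
      ((runs_pop a σ).seq ((runs_push a true _).seq (runs_pop c _)))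
    refine (Runs.loop (by simp [hc]) hb (runs_loop_nil ?_)).congr (by omega) ?_
    · simp [Function.update_of_ne hac.symm, hc]
    · funext i
      simp only [Function.update_apply]
      split_ifs <;> simp_all
  | succ j ih =>
    have ha' : σ a = true :: (List.replicate j true ++ false :: v) := by
      simpa [List.replicate_succ] using ha
    have hb := Runs.branch_true (pF := .seq (.pop a) (.seq (.push a true) (.pop c)))
      (pE := .seq (.pop c) (.pop h)) ha' ((runs_pop a σ).seq (runs_push t true _))
    refine (Runs.loop (by simp [hc]) hb (ih ?_ ?_)).congr (by omega) ?_
    · simp [Function.update_of_ne hat, ha']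
    · simp [Function.update_of_ne hac.symm, Function.update_of_ne htc.symm, hc]
    · funext i
      simp only [Function.update_apply]
      split_ifs <;> simp_all [List.replicate_succ']

lemma runs_carry_overflow {a t c h : ℕ} (hat : a ≠ t) (hac : a ≠ c) (hah : a ≠ h) (htc : t ≠ c)
    (hth : t ≠ h) (hch : c ≠ h)
    (j : ℕ) {σ : Store} (ha : σ a = List.replicate j true)
    (hc : σ c = [true]) :
    Runs (.carry a t c h) σ (5 * j + 9)
      (Function.update (Function.update (Function.update (Function.update σ a []) t
        (List.replicate j true ++ σ t)) c []) h (σ h).tail) := by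
  induction j generalizing σ with
  | zero =>
    have hb := Runs.branch_nil (pT := .seq (.pop a) (.push t true))
      (pF := .seq (.pop a) (.seq (.push a true) (.pop c)))
      (show σ a = [] by simpa using ha) ((runs_pop c σ).seq (runs_pop h _))
    refine (Runs.loop (by simp [hc]) hb (runs_loop_nil ?_)).congr (by omega) ?_
    · simp [Function.update_of_ne hch, hc]
    · funext i
      simp only [Function.update_apply]
      split_ifs <;> simp_all
  | succ j ih =>
    have ha' : σ a = true :: List.replicate j true := by
      simpa [List.replicate_succ] using ha
    have hb := Runs.branch_true (pF := .seq (.pop a) (.seq (.push a true) (.pop c)))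
      (pE := .seq (.pop c) (.pop h)) ha' ((runs_pop a σ).seq (runs_push t true _))
    refine (Runs.loop (by simp [hc]) hb (ih ?_ ?_)).congr (by omega) ?_
    · simp [Function.update_of_ne hat, ha']
    · simp [Function.update_of_ne hac.symm, Function.update_of_ne htc.symm, hc]
    · funext i
      simp only [Function.update_apply]
      split_ifs <;> simp_all [List.replicate_succ']

lemma runs_refill {a t : ℕ} (hat : a ≠ t) (j : ℕ) {σ : Store} (ht : σ t = List.replicate j true) :
    Runs (.loop t (.seq (.pop t) (.push a false))) σ (4 * j + 1)
      (Function.update (Function.update σ t []) a (List.replicate j false ++ σ a)) := by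
  induction j generalizing σ with
  | zero => exact (runs_loop_nil ht).congr (by omega) (by simp at ht; simp [← ht])
  | succ j ih =>
    refine (Runs.loop (by simp [ht, List.replicate_succ]) ((runs_pop t σ).seq (runs_push a false _))
      (ih ?_)).congr (by omega) ?_
    · simp [Function.update_of_ne hat.symm, ht]
    · funext i
      simp only [Function.update_apply]
      split_ifs <;> simp_all [List.replicate_succ']

/-- The least significant digit is on top. The initial run of ones is counted on `t`, the first zero
becomes a one, and the run is put back as zeros. -/
lemma runs_increment {a t c h : ℕ} (hat : a ≠ t) (hac : a ≠ c) (htc : t ≠ c) {σ : Store} (ht : σ t = []) (hc : σ c = [])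
    (hlt : binValue (σ a) + 1 < 2 ^ (σ a).length) :
    ∃ v, v.length = (σ a).length ∧ binValue v = binValue (σ a) + 1 ∧
      Runs (.increment a t c h) σ (9 * (σ a).length + 14) (Function.update σ a v) := by
  rcases eq_replicate_true_or_carry (σ a) with ha | ⟨j, v, ha⟩
  · have := binValue_replicate_true (σ a).length
    rw [← ha] at this
    omega
  · refine ⟨List.replicate j false ++ true :: v, by simp [ha], by rw [ha, binValue_carry], ?_⟩
    refine ((runs_push c true σ).seq ((runs_carry (h := h) hat hac htc j (v := v) ?_ ?_).seq
      (runs_refill (a := a) (j := j) hat ?_))).congr ?_ ?_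
    · simp [Function.update_of_ne hac, ha]
    · simp [hc]
    · simp [Function.update_of_ne htc, ht]
    · simp [ha]
      omega
    · funext i
      simp only [Function.update_apply]
      split_ifs <;> simp_all

/-- Here all digits are ones, so the carry loop meets the bottom of `a` and pops `h`. With a single
bit on `h`, this is the signal that ends the enumeration. -/
lemma runs_increment_overflow {a t c h : ℕ} (hat : a ≠ t) (hac : a ≠ c) (hah : a ≠ h)
    (htc : t ≠ c) (hth : t ≠ h) (hch : c ≠ h)
    {σ : Store} (ht : σ t = []) (hc : σ c = [])
    (hlt : binValue (σ a) + 1 = 2 ^ (σ a).length) :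
    Runs (.increment a t c h) σ (9 * (σ a).length + 14)
      (Function.update (Function.update σ a (List.replicate (σ a).length false)) h
        (σ h).tail) := by
  have ha : σ a = List.replicate (σ a).length true := by
    refine eq_of_binValue_eq (by simp) ?_
    have := binValue_replicate_true (σ a).length
    omega
  generalize (σ a).length = l at *
  refine ((runs_push c true σ).seq ((runs_carry_overflow hat hac hah htc hth hch l ?_ ?_).seq
    (runs_refill (a := a) (j := l) hat ?_))).congr (by omega) ?_
  · simpa [Function.update_of_ne hac] using ha
  · simp [hc]
  · simp [Function.update_of_ne hth, Function.update_of_ne htc, ht]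
  · funext i
    simp only [Function.update_apply]
    split_ifs <;> simp_all

/-! ### Formulas whose variables are natural numbers -/

/-- A literal whose variable is an arbitrary natural number. -/
abbrev RawLiteral : Type := ℕ × Bool

/-- A clause whose variables are arbitrary natural numbers. -/
abbrev RawClause : Type := RawLiteral × RawLiteral × RawLiteral

/-- The truth value of a literal. -/
def RawLiteral.eval (X : ℕ → Bool) (l : RawLiteral) : Bool := X l.1 == l.2

/-- The truth value of a clause. -/
def RawClause.eval (X : ℕ → Bool) (c : RawClause) : Bool :=
  RawLiteral.eval X c.1 || RawLiteral.eval X c.2.1 || RawLiteral.eval X c.2.2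

/-- All variables of the clause are less than `N`. -/
def RawClause.Bounded (N : ℕ) (c : RawClause) : Prop :=
  c.1.1 < N ∧ c.2.1.1 < N ∧ c.2.2.1 < N

lemma RawClause.Bounded.mono {N M : ℕ} (h : N ≤ M) {c : RawClause} (hc : c.Bounded N) :
    c.Bounded M :=
  ⟨hc.1.trans_le h, hc.2.1.trans_le h, hc.2.2.trans_le h⟩

lemma RawClause.Bounded.eval_congr {N : ℕ} {c : RawClause} (hc : c.Bounded N) {X Y : ℕ → Bool}
    (h : ∀ i < N, X i = Y i) : c.eval X = c.eval Y := by
  simp only [RawClause.eval, RawLiteral.eval, h _ hc.1, h _ hc.2.1, h _ hc.2.2]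

/-- The encoding of a literal as a bit string. -/
def RawLiteral.encode (l : RawLiteral) : List Bool := l.2 :: encodeNat l.1

/-- The encoding of a clause as a bit string. -/
def RawClause.encode (c : RawClause) : List Bool :=
  RawLiteral.encode c.1 ++ RawLiteral.encode c.2.1 ++ RawLiteral.encode c.2.2

/-- The encodings of the clauses in a list, in order. -/
def encodeClauses (cs : List RawClause) : List Bool := cs.flatMap RawClause.encode

/-- Forget the number of variables. -/
def Clause.toRaw {n : ℕ} (c : Clause n) : RawClause :=
  ((c.1.1, c.1.2), (c.2.1.1, c.2.1.2), (c.2.2.1, c.2.2.2))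

lemma Clause.toRaw_bounded {n : ℕ} (c : Clause n) : c.toRaw.Bounded n :=
  ⟨c.1.1.2, c.2.1.1.2, c.2.2.1.2⟩

lemma Clause.eval_toRaw {n : ℕ} (c : Clause n) {x : Fin n → Bool} {X : ℕ → Bool}
    (h : ∀ i : Fin n, X i = x i) : c.toRaw.eval X = c.eval x := by
  simp [RawClause.eval, RawLiteral.eval, Clause.eval, Literal.eval, Clause.toRaw, h]

lemma encode_eq {n : ℕ} (φ : Formula n) :
    encode φ = encodeNat n ++ encodeNat φ.length ++ encodeClauses (φ.map Clause.toRaw) := by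
  simp only [encode, encodeClauses, List.flatMap_map]
  rfl

lemma countP_toRaw {n : ℕ} (φ : Formula n) {x : Fin n → Bool} {X : ℕ → Bool}
    (h : ∀ i : Fin n, X i = x i) :
    (φ.map Clause.toRaw).countP (RawClause.eval X) = φ.countP (Clause.eval x) := by
  rw [List.countP_map]
  refine List.countP_congr fun c _ => ?_
  simp [Clause.eval_toRaw c h]

lemma exists_formula {N : ℕ} (cs : List RawClause) (h : ∀ c ∈ cs, c.Bounded N) :
    ∃ ψ : Formula N, ψ.map Clause.toRaw = cs := by
  induction cs with
  | nil => exact ⟨[], rfl⟩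
  | cons c cs ih =>
    obtain ⟨ψ, hψ⟩ := ih fun d hd => h d (List.mem_cons_of_mem c hd)
    obtain ⟨h1, h2, h3⟩ := h c (by simp)
    exact ⟨((⟨c.1.1, h1⟩, c.1.2), (⟨c.2.1.1, h2⟩, c.2.1.2), (⟨c.2.2.1, h3⟩, c.2.2.2)) :: ψ,
      by simp [hψ, Clause.toRaw]⟩

/-! ### The gadget that enforces that enough clauses of a group are satisfied

Every group of `k` clauses has its own block of auxiliary variables: `satVar c` asserts that
the `c`-th clause of the group is satisfied, `tailVar c` that one of its last two literals is,
and `countVar c j` that at least `j` of the clauses `c, …, k - 1` are. -/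

/-- The variable for the satisfaction of clause `c`. -/
def satVar (c : ℕ) : ℕ := Nat.pair c 0

/-- The variable for the satisfaction of one of the last two literals of clause `c`. -/
def tailVar (c : ℕ) : ℕ := Nat.pair c 1

/-- The variable for the satisfaction of at least `j` clauses from clause `c` on. -/
def countVar (c j : ℕ) : ℕ := Nat.pair c (j + 2)

/-- The number of auxiliary variables of a group. -/
def blockSize (k : ℕ) : ℕ := (k + 3) ^ 2

/-- The number of clauses of the gadget of a group. -/
def gadgetSize (k : ℕ) : ℕ := k * (2 * k + 2) + k + 1

/-- The second component of a `countVar` goes up to `k + 2`, and `Nat.pair` is below the square of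
one more than the larger component. -/
lemma pair_lt_blockSize {k c j : ℕ} (hc : c ≤ k) (hj : j ≤ k + 2) :
    Nat.pair c j < blockSize k := by
  refine (Nat.pair_lt_max_add_one_sq c j).trans_le (Nat.pow_le_pow_left ?_ 2)
  have := max_le (hc.trans (by omega : k ≤ k + 2)) hj
  omega

/-- Add `o` to the variables of a clause. -/
def RawClause.shift (o : ℕ) (c : RawClause) : RawClause :=
  ((o + c.1.1, c.1.2), (o + c.2.1.1, c.2.1.2), (o + c.2.2.1, c.2.2.2))

/-- The clauses that relate the counts from clause `c` on to those from clause `c + 1` on. -/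
def countClauses (k c : ℕ) : List RawClause :=
  (List.range k).flatMap fun i =>
    [((countVar c (i + 1), false), (countVar (c + 1) (i + 1), true), (satVar c, true)),
      ((countVar c (i + 1), false), (countVar (c + 1) i, true), (countVar (c + 1) i, true))]

/-- The clauses for a clause that is missing from its group. -/
def missingClauses (c : ℕ) : List RawClause :=
  [((satVar c, false), (satVar c, false), (satVar c, false)),
    ((satVar c, false), (satVar c, false), (satVar c, false))]

/-- The clauses that define `satVar c` and `tailVar c` for the clause `cl`. -/
def linkClauses (o c : ℕ) (cl : RawClause) : List RawClause :=
  [((o + tailVar c, false), cl.2.2, cl.2.1), ((o + satVar c, false), (o + tailVar c, true), cl.1)]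

/-- The clauses that bound the counts from clause `k` on. -/
def finalClauses (k : ℕ) : List RawClause :=
  (List.range k).map fun i =>
    ((countVar k (i + 1), false), (countVar k (i + 1), false), (countVar k (i + 1), false))

/-- The clause that asserts that at least `a` clauses are satisfied. -/
def startClause (a : ℕ) : RawClause :=
  ((countVar 0 a, true), (countVar 0 a, true), (countVar 0 a, true))

/-- The clauses for the `c`-th clause of a group. -/
def slotClauses (k o c : ℕ) : Option RawClause → List RawClause
  | none => (countClauses k c).map (RawClause.shift o) ++ (missingClauses c).map (RawClause.shift o)
  | some cl => (countClauses k c).map (RawClause.shift o) ++ linkClauses o c cl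

/-- The clauses for `r` clauses of a group from the `c`-th on, which are taken from a list. -/
def slotsClauses (k o c : ℕ) : ℕ → List RawClause → List RawClause
  | 0, _ => []
  | r + 1, cs => slotsClauses k o (c + 1) r cs.tail ++ slotClauses k o c cs.head?

/-- The gadget that enforces that at least `a` of the first `k` clauses of `cs` are satisfied. -/
def groupClauses (k o a : ℕ) (cs : List RawClause) : List RawClause :=
  slotsClauses k o 0 k cs ++ ((finalClauses k).map (RawClause.shift o) ++
    [(startClause a).shift o])

/-- The gadgets for consecutive groups of `k` clauses of `cs`, with the thresholds `ds`. -/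
def thresholdClauses (k : ℕ) : ℕ → List ℕ → List RawClause → List RawClause
  | _, [], _ => []
  | o, a :: ds, cs =>
    thresholdClauses k (o + blockSize k) ds (cs.drop k) ++ groupClauses k o a cs

/-! ### Size of the gadget and range of its variables -/

lemma length_countClauses (k c : ℕ) : (countClauses k c).length = 2 * k := by
  simp [countClauses, mul_comm]

/-- The repeated clause in `missingClauses` matches the two link clauses. The size of the gadget
thus depends neither on the guess nor on whether the last group is full. -/
lemma length_slotClauses (k o c : ℕ) (x : Option RawClause) :
    (slotClauses k o c x).length = 2 * k + 2 := by
  cases x <;> simp [slotClauses, length_countClauses, missingClauses, linkClauses]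

lemma length_slotsClauses (k o c r : ℕ) (cs : List RawClause) :
    (slotsClauses k o c r cs).length = r * (2 * k + 2) := by
  induction r generalizing c cs with
  | zero => simp [slotsClauses]
  | succ r ih => simp [slotsClauses, ih, length_slotClauses]; ring

lemma length_groupClauses (k o a : ℕ) (cs : List RawClause) :
    (groupClauses k o a cs).length = gadgetSize k := by
  simp [groupClauses, length_slotsClauses, finalClauses, gadgetSize]
  ring

lemma length_thresholdClauses (k o : ℕ) (ds : List ℕ) (cs : List RawClause) :
    (thresholdClauses k o ds cs).length = ds.length * gadgetSize k := by
  induction ds generalizing o cs with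
  | nil => simp [thresholdClauses]
  | cons a ds ih => simp [thresholdClauses, ih, length_groupClauses]; ring

lemma RawClause.Bounded.shift {N o : ℕ} {c : RawClause} (h : c.Bounded N) :
    (c.shift o).Bounded (o + N) := by
  obtain ⟨h1, h2, h3⟩ := h
  exact ⟨by simp [RawClause.shift, h1], by simp [RawClause.shift, h2],
    by simp [RawClause.shift, h3]⟩

lemma countClauses_bounded {k c : ℕ} (hc : c < k) :
    ∀ cl ∈ countClauses k c, cl.Bounded (blockSize k) := by
  intro cl hcl
  simp only [countClauses, List.mem_flatMap, List.mem_range, List.mem_cons, List.not_mem_nil,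
    or_false] at hcl
  obtain ⟨i, hi, hcl⟩ := hcl
  have h1 : countVar c (i + 1) < blockSize k := pair_lt_blockSize (by omega) (by omega)
  have h2 : countVar (c + 1) (i + 1) < blockSize k := pair_lt_blockSize (by omega) (by omega)
  have h3 : countVar (c + 1) i < blockSize k := pair_lt_blockSize (by omega) (by omega)
  have h4 : satVar c < blockSize k := pair_lt_blockSize (by omega) (by omega)
  obtain rfl | rfl := hcl
  · exact ⟨h1, h2, h4⟩
  · exact ⟨h1, h3, h3⟩

lemma missingClauses_bounded {k c : ℕ} (hc : c < k) :
    ∀ cl ∈ missingClauses c, cl.Bounded (blockSize k) := by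
  have h : satVar c < blockSize k := pair_lt_blockSize hc.le (by omega)
  simp [missingClauses, RawClause.Bounded, h]

lemma finalClauses_bounded (k : ℕ) : ∀ cl ∈ finalClauses k, cl.Bounded (blockSize k) := by
  intro cl hcl
  simp only [finalClauses, List.mem_map, List.mem_range] at hcl
  obtain ⟨i, hi, rfl⟩ := hcl
  have h : countVar k (i + 1) < blockSize k := pair_lt_blockSize le_rfl (by omega)
  exact ⟨h, h, h⟩

lemma startClause_bounded {k a : ℕ} (ha : a ≤ k) : (startClause a).Bounded (blockSize k) := by
  have h : countVar 0 a < blockSize k := pair_lt_blockSize (by omega) (by omega)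
  exact ⟨h, h, h⟩

lemma slotClauses_bounded {k o c : ℕ} (hc : c < k) {x : Option RawClause}
    (hx : ∀ cl ∈ x, cl.Bounded o) : ∀ cl ∈ slotClauses k o c x, cl.Bounded (o + blockSize k) := by
  have hsat : satVar c < blockSize k := pair_lt_blockSize hc.le (by omega)
  have htail : tailVar c < blockSize k := pair_lt_blockSize hc.le (by omega)
  intro cl hcl
  rcases x with _ | d
  · simp only [slotClauses, List.mem_append, List.mem_map] at hcl
    obtain ⟨d, hd, rfl⟩ | ⟨d, hd, rfl⟩ := hcl
    · exact (countClauses_bounded hc d hd).shift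
    · exact (missingClauses_bounded hc d hd).shift
  · simp only [slotClauses, List.mem_append, List.mem_map] at hcl
    obtain ⟨d, hd, rfl⟩ | hcl := hcl
    · exact (countClauses_bounded hc d hd).shift
    · obtain ⟨h1, h2, h3⟩ := hx d rfl
      simp only [linkClauses, List.mem_cons, List.not_mem_nil, or_false] at hcl
      obtain rfl | rfl := hcl
      · exact ⟨by simpa using htail, by simpa using by omega, by simpa using by omega⟩
      · exact ⟨by simpa using hsat, by simpa using htail, by simpa using by omega⟩

lemma slotsClauses_bounded {k o c r : ℕ} (hc : c + r ≤ k) {cs : List RawClause}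
    (hcs : ∀ cl ∈ cs, cl.Bounded o) :
    ∀ cl ∈ slotsClauses k o c r cs, cl.Bounded (o + blockSize k) := by
  induction r generalizing c cs with
  | zero => simp [slotsClauses]
  | succ r ih =>
    intro cl hcl
    rw [slotsClauses, List.mem_append] at hcl
    obtain hcl | hcl := hcl
    · exact ih (by omega) (fun d hd => hcs d (List.mem_of_mem_tail hd)) cl hcl
    · exact slotClauses_bounded (by omega) (fun d hd => hcs d (List.mem_of_mem_head? hd)) cl hcl

lemma groupClauses_bounded {k o a : ℕ} (ha : a ≤ k) {cs : List RawClause}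
    (hcs : ∀ cl ∈ cs, cl.Bounded o) :
    ∀ cl ∈ groupClauses k o a cs, cl.Bounded (o + blockSize k) := by
  intro cl hcl
  simp only [groupClauses, List.mem_append, List.mem_map, List.mem_singleton] at hcl
  obtain hcl | ⟨d, hd, rfl⟩ | rfl := hcl
  · exact slotsClauses_bounded (by omega) hcs cl hcl
  · exact (finalClauses_bounded k d hd).shift
  · exact (startClause_bounded ha).shift

lemma thresholdClauses_bounded {k o : ℕ} {ds : List ℕ} (hds : ∀ a ∈ ds, a ≤ k)
    {cs : List RawClause} (hcs : ∀ cl ∈ cs, cl.Bounded o) :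
    ∀ cl ∈ thresholdClauses k o ds cs, cl.Bounded (o + ds.length * blockSize k) := by
  induction ds generalizing o cs with
  | nil => simp [thresholdClauses]
  | cons a ds ih =>
    intro cl hcl
    rw [thresholdClauses, List.mem_append] at hcl
    obtain hcl | hcl := hcl
    · refine (ih (fun d hd => hds d (List.mem_cons_of_mem a hd)) ?_ cl hcl).mono ?_
      · exact fun d hd => (hcs d (List.mem_of_mem_drop hd)).mono (by omega)
      · rw [List.length_cons, add_mul]
        omega
    · refine (groupClauses_bounded (hds a (by simp)) hcs cl hcl).mono ?_
      rw [List.length_cons, add_mul]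
      omega

/-! ### Soundness of the gadget -/

lemma countP_take_succ (p : RawClause → Bool) (r : ℕ) (cs : List RawClause) :
    (cs.take (r + 1)).countP p = (cs.tail.take r).countP p + if cs.head?.any p then 1 else 0 := by
  cases cs with
  | nil => simp
  | cons c cs => cases h : p c <;> simp [h]

/-- The two clauses say that `u` implies `v` or the first literal, and that `v` implies one of the
other two. Only implications from auxiliary variables to the clause are needed for soundness. -/
lemma eval_of_linkClauses {X : ℕ → Bool} {u v : ℕ} {cl : RawClause} (hu : X u = true)
    (h1 : RawClause.eval X ((v, false), cl.2.2, cl.2.1) = true)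
    (h2 : RawClause.eval X ((u, false), (v, true), cl.1) = true) : cl.eval X = true := by
  obtain ⟨l1, l2, l3⟩ := cl
  simp only [RawClause.eval, RawLiteral.eval, hu] at h1 h2 ⊢
  revert h1 h2
  cases X v <;> cases (X l1.1 == l1.2) <;> cases (X l2.1 == l2.2) <;> cases (X l3.1 == l3.2) <;>
    decide

/-- Induction from the end of the group backwards. After the last clause, `finalClauses` forbids
every positive count. Before it, a count that is claimed at `c` is passed on to `c + 1`, reduced by
one only if clause `c` is asserted to hold. -/
lemma le_countP_of_countVar {k o : ℕ} {X : ℕ → Bool}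
    (hfinal : ∀ cl ∈ (finalClauses k).map (RawClause.shift o), cl.eval X = true) (r c : ℕ)
    (cs : List RawClause) (hc : c + r = k)
    (h : ∀ cl ∈ slotsClauses k o c r cs, cl.eval X = true) (j : ℕ) (hj : j ≤ k)
    (hX : X (o + countVar c j) = true) : j ≤ (cs.take r).countP (RawClause.eval X) := by
  induction r generalizing c cs j with
  | zero =>
    obtain _ | i := j
    · omega
    · exfalso
      have := hfinal _ (List.mem_map_of_mem (List.mem_map_of_mem (List.mem_range.2 hj)))
      obtain rfl : c = k := hc
      simp [RawClause.eval, RawLiteral.eval, RawClause.shift, hX] at this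
  | succ r ih =>
    obtain _ | i := j
    · omega
    have hi : i < k := hj
    rw [countP_take_succ]
    have hrec := ih (c + 1) cs.tail (by omega)
      fun cl hcl => h cl (List.mem_append_left _ hcl)
    have hslot : ∀ cl ∈ slotClauses k o c cs.head?, cl.eval X = true :=
      fun cl hcl => h cl (List.mem_append_right _ hcl)
    have hcount : ∀ cl ∈ countClauses k c, (cl.shift o).eval X = true := by
      intro cl hcl
      refine hslot _ ?_
      cases cs.head? <;> exact List.mem_append_left _ (List.mem_map_of_mem hcl)
    have h1 := hcount _ (List.mem_flatMap.2 ⟨i, List.mem_range.2 hi, List.mem_cons_self⟩)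
    have h2 := hcount _ (List.mem_flatMap.2 ⟨i, List.mem_range.2 hi,
      List.mem_cons_of_mem _ List.mem_cons_self⟩)
    simp only [RawClause.eval, RawLiteral.eval, RawClause.shift, hX] at h1 h2
    simp only [beq_true, Bool.or_eq_true] at h1 h2
    have h2' := hrec i hi.le (by simpa using h2)
    -- If `satVar c` is true, the clause exists and holds, and the count `i` from `c + 1` on
    -- supplies the rest; otherwise the full count `i + 1` is inherited.
    by_cases hs : X (o + satVar c) = true
    · have hhead : cs.head?.any (RawClause.eval X) = true := by
        rcases hd : cs.head? with _ | cl
        · have := hslot (RawClause.shift o ((satVar c, false), (satVar c, false), (satVar c, false)))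
            (by rw [hd]; exact List.mem_append_right _ (by simp [missingClauses]))
          simp [RawClause.eval, RawLiteral.eval, RawClause.shift, hs] at this
        · have h3 := hslot ((o + tailVar c, false), cl.2.2, cl.2.1)
            (by rw [hd]; exact List.mem_append_right _ (by simp [linkClauses]))
          have h4 := hslot ((o + satVar c, false), (o + tailVar c, true), cl.1)
            (by rw [hd]; exact List.mem_append_right _ (by simp [linkClauses]))
          exact eval_of_linkClauses hs h3 h4
      rw [if_pos hhead]
      omega
    · have := hrec (i + 1) hj (by simpa [hs] using h1)
      omega

lemma le_countP_of_groupClauses {k o a : ℕ} (ha : a ≤ k) {X : ℕ → Bool} {cs : List RawClause}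
    (h : ∀ cl ∈ groupClauses k o a cs, cl.eval X = true) :
    a ≤ (cs.take k).countP (RawClause.eval X) := by
  refine le_countP_of_countVar (o := o) (fun cl hcl => h cl ?_) k 0 cs (by omega)
    (fun cl hcl => h cl ?_) a ha ?_
  · exact List.mem_append_right _ (List.mem_append_left _ hcl)
  · exact List.mem_append_left _ hcl
  · have := h ((startClause a).shift o)
      (List.mem_append_right _ (List.mem_append_right _ (by simp)))
    simpa [RawClause.eval, RawLiteral.eval, RawClause.shift, startClause] using this

/-- If the thresholds exceed the number of satisfied clauses, many clauses of the gadgets are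
violated. -/
lemma sum_le_countP_add {k o : ℕ} (X : ℕ → Bool) (ds : List ℕ) (hds : ∀ a ∈ ds, a ≤ k)
    (cs : List RawClause) :
    ds.sum ≤ cs.countP (RawClause.eval X) +
      k * (thresholdClauses k o ds cs).countP fun cl => !cl.eval X := by
  induction ds generalizing o cs with
  | nil => simp
  | cons a ds ih =>
    have h1 := ih (o := o + blockSize k) (fun d hd => hds d (List.mem_cons_of_mem a hd))
      (cs.drop k)
    have h2 : a ≤ (cs.take k).countP (RawClause.eval X) +
        k * (groupClauses k o a cs).countP fun cl => !cl.eval X := by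
      have ha : a ≤ k := hds a (by simp)
      -- A group without a violated gadget clause meets its threshold. Otherwise a single violated
      -- clause, weighted by `k`, already pays for the whole threshold, as `a ≤ k`.
      rcases Nat.eq_zero_or_pos ((groupClauses k o a cs).countP fun cl => !cl.eval X) with h | h
      · refine (le_countP_of_groupClauses (o := o) ha fun cl hcl => ?_).trans (Nat.le_add_right _ _)
        simpa using List.countP_eq_zero.1 h cl hcl
      · nlinarith
    have h3 : cs.countP (RawClause.eval X) = (cs.take k).countP (RawClause.eval X) +
        (cs.drop k).countP (RawClause.eval X) := by
      rw [← List.countP_append, List.take_append_drop]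
    rw [List.sum_cons, thresholdClauses, List.countP_append, mul_add]
    omega

/-! ### Completeness of the gadget -/

/-- The values of the auxiliary variables of a group. -/
def blockValue (k : ℕ) (x : ℕ → Bool) (cs : List RawClause) (v : ℕ) : Bool :=
  match (Nat.unpair v).2 with
  | 0 => (cs.drop (Nat.unpair v).1).head?.any (RawClause.eval x)
  | 1 => (cs.drop (Nat.unpair v).1).head?.any fun cl =>
      RawLiteral.eval x cl.2.1 || RawLiteral.eval x cl.2.2
  | j + 2 => decide (j ≤ ((cs.drop (Nat.unpair v).1).take (k - (Nat.unpair v).1)).countP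
      (RawClause.eval x))

/-- Extend an assignment of the variables below `o` to the auxiliary variables of a group. -/
def extendBlock (k o : ℕ) (x : ℕ → Bool) (cs : List RawClause) (i : ℕ) : Bool :=
  if i < o then x i else blockValue k x cs (i - o)

lemma extendBlock_of_lt {k o : ℕ} {x : ℕ → Bool} {cs : List RawClause} {i : ℕ} (h : i < o) :
    extendBlock k o x cs i = x i := if_pos h

lemma extendBlock_satVar (k o : ℕ) (x : ℕ → Bool) (cs : List RawClause) (c : ℕ) :
    extendBlock k o x cs (o + satVar c) = (cs.drop c).head?.any (RawClause.eval x) := by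
  simp [extendBlock, blockValue, satVar]

lemma extendBlock_tailVar (k o : ℕ) (x : ℕ → Bool) (cs : List RawClause) (c : ℕ) :
    extendBlock k o x cs (o + tailVar c) = (cs.drop c).head?.any fun cl =>
      RawLiteral.eval x cl.2.1 || RawLiteral.eval x cl.2.2 := by
  simp [extendBlock, blockValue, tailVar]

lemma extendBlock_countVar (k o : ℕ) (x : ℕ → Bool) (cs : List RawClause) (c j : ℕ) :
    extendBlock k o x cs (o + countVar c j) =
      decide (j ≤ ((cs.drop c).take (k - c)).countP (RawClause.eval x)) := by
  simp [extendBlock, blockValue, countVar]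

/-- The true counts obey the recursion `countP_take_succ`, which is what the counting clauses
express. The literals of the given clause keep their values because their variables lie below `o`.
-/
lemma eval_extendBlock_slot {k o c : ℕ} (hck : c < k) {x : ℕ → Bool} {cs : List RawClause}
    (hcs : ∀ cl ∈ cs, cl.Bounded o) :
    ∀ cl ∈ slotClauses k o c (cs.drop c).head?, cl.eval (extendBlock k o x cs) = true := by
  have hcount : ∀ cl ∈ (countClauses k c).map (RawClause.shift o),
      cl.eval (extendBlock k o x cs) = true := by
    intro cl hcl
    simp only [countClauses, List.mem_map, List.mem_flatMap, List.mem_range, List.mem_cons,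
      List.not_mem_nil, or_false] at hcl
    have hsucc := countP_take_succ (RawClause.eval x) (k - (c + 1)) (cs.drop c)
    rw [List.tail_drop, show k - (c + 1) + 1 = k - c by omega] at hsucc
    obtain ⟨_, ⟨i, hi, rfl | rfl⟩, rfl⟩ := hcl
    · simp only [RawClause.eval, RawLiteral.eval, RawClause.shift, extendBlock_satVar,
        extendBlock_countVar]
      cases hh : (cs.drop c).head?.any (RawClause.eval x)
      · rw [hh] at hsucc
        rw [hsucc]
        simp
      · simp
    · simp only [RawClause.eval, RawLiteral.eval, RawClause.shift, extendBlock_countVar, hsucc]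
      split_ifs <;> simp; omega
  intro cl hcl
  rcases hd : (cs.drop c).head? with _ | d
  · rw [hd, slotClauses, List.mem_append] at hcl
    refine hcl.elim (hcount cl) fun hcl => ?_
    simp only [missingClauses, List.mem_map, List.mem_cons, List.not_mem_nil, or_false,
      or_self, exists_eq_left] at hcl
    subst hcl
    simp [RawClause.eval, RawLiteral.eval, RawClause.shift, extendBlock_satVar, hd]
  · rw [hd, slotClauses, List.mem_append] at hcl
    refine hcl.elim (hcount cl) fun hcl => ?_
    obtain ⟨h1, h2, h3⟩ := hcs d (List.mem_of_mem_drop (List.mem_of_mem_head? hd))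
    simp only [linkClauses, List.mem_cons, List.not_mem_nil, or_false] at hcl
    obtain rfl | rfl := hcl <;>
      simp only [RawClause.eval, RawLiteral.eval, extendBlock_satVar, extendBlock_tailVar, hd,
        extendBlock_of_lt h1, extendBlock_of_lt h2, extendBlock_of_lt h3, Option.any_some] <;>
      cases (x d.1.1 == d.1.2) <;> cases (x d.2.1.1 == d.2.1.2) <;>
      cases (x d.2.2.1 == d.2.2.2) <;> rfl

lemma eval_extendBlock_slots {k o : ℕ} {x : ℕ → Bool} {cs : List RawClause}
    (hcs : ∀ cl ∈ cs, cl.Bounded o) (r c : ℕ) (hc : c + r = k) :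
    ∀ cl ∈ slotsClauses k o c r (cs.drop c), cl.eval (extendBlock k o x cs) = true := by
  induction r generalizing c with
  | zero => simp [slotsClauses]
  | succ r ih =>
    intro cl hcl
    rw [slotsClauses, List.mem_append, List.tail_drop] at hcl
    exact hcl.elim (ih (c + 1) (by omega) cl) (eval_extendBlock_slot (by omega) hcs cl)

/-- The threshold is the exact count, so the start clause holds. No clause of the group is left from
position `k` on, so the final clauses hold as well. -/
lemma eval_extendBlock_group {k o : ℕ} {x : ℕ → Bool} {cs : List RawClause}
    (hcs : ∀ cl ∈ cs, cl.Bounded o) :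
    ∀ cl ∈ groupClauses k o ((cs.take k).countP (RawClause.eval x)) cs,
      cl.eval (extendBlock k o x cs) = true := by
  intro cl hcl
  simp only [groupClauses, List.mem_append, List.mem_map, List.mem_singleton] at hcl
  obtain hcl | ⟨d, hd, rfl⟩ | rfl := hcl
  · exact eval_extendBlock_slots hcs k 0 (by omega) cl (by simpa using hcl)
  · simp only [finalClauses, List.mem_map, List.mem_range] at hd
    obtain ⟨i, hi, rfl⟩ := hd
    simp [RawClause.eval, RawLiteral.eval, RawClause.shift, extendBlock_countVar]
  · simp [RawClause.eval, RawLiteral.eval, RawClause.shift, startClause, extendBlock_countVar]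

/-! ### The correct guess for an assignment -/

/-- The numbers of satisfied clauses in `g` consecutive groups of `k` clauses. -/
def satCounts (k : ℕ) (x : ℕ → Bool) : ℕ → List RawClause → List ℕ
  | 0, _ => []
  | g + 1, cs => (cs.take k).countP (RawClause.eval x) :: satCounts k x g (cs.drop k)

lemma length_satCounts (k : ℕ) (x : ℕ → Bool) (g : ℕ) (cs : List RawClause) :
    (satCounts k x g cs).length = g := by
  induction g generalizing cs with
  | zero => rfl
  | succ g ih => simp [satCounts, ih]

lemma satCounts_le (k : ℕ) (x : ℕ → Bool) (g : ℕ) (cs : List RawClause) :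
    ∀ a ∈ satCounts k x g cs, a ≤ k := by
  induction g generalizing cs with
  | zero => simp [satCounts]
  | succ g ih =>
    intro a ha
    rw [satCounts, List.mem_cons] at ha
    obtain rfl | ha := ha
    · exact List.countP_le_length.trans (by simp)
    · exact ih _ a ha

lemma sum_satCounts {k : ℕ} (x : ℕ → Bool) (g : ℕ) (cs : List RawClause)
    (h : cs.length ≤ g * k) : (satCounts k x g cs).sum = cs.countP (RawClause.eval x) := by
  induction g generalizing cs with
  | zero =>
    obtain rfl : cs = [] := List.length_eq_zero_iff.1 (by omega)
    simp [satCounts]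
  | succ g ih =>
    rw [satCounts, List.sum_cons, ih _ (by rw [List.length_drop]; rw [add_mul] at h; omega),
      ← List.countP_append, List.take_append_drop]

lemma satCounts_congr {k : ℕ} {x y : ℕ → Bool} (g : ℕ) {cs : List RawClause}
    (h : ∀ cl ∈ cs, cl.eval x = cl.eval y) : satCounts k x g cs = satCounts k y g cs := by
  induction g generalizing cs with
  | zero => rfl
  | succ g ih =>
    rw [satCounts, satCounts, ih fun cl hcl => h cl (List.mem_of_mem_drop hcl),
      List.countP_congr fun cl hcl => by rw [h cl (List.mem_of_mem_take hcl)]]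

/-- The blocks are disjoint, so the assignment is extended one block at a time. Extending it changes
none of the original clauses, hence none of the later counts, and the later blocks do not disturb
the gadget already satisfied. -/
lemma exists_eval_thresholdClauses {k o : ℕ} (x : ℕ → Bool) (g : ℕ) {cs : List RawClause}
    (hcs : ∀ cl ∈ cs, cl.Bounded o) :
    ∃ X : ℕ → Bool, (∀ i < o, X i = x i) ∧
      ∀ cl ∈ thresholdClauses k o (satCounts k x g cs) cs, cl.eval X = true := by
  induction g generalizing o x cs with
  | zero => exact ⟨x, by simp, by simp [satCounts, thresholdClauses]⟩
  | succ g ih =>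
    have hdrop : ∀ cl ∈ cs.drop k, cl.Bounded o := fun cl hcl => hcs cl (List.mem_of_mem_drop hcl)
    obtain ⟨X, hX, hsat⟩ := ih (o := o + blockSize k) (extendBlock k o x cs)
      (cs := cs.drop k) fun cl hcl => (hdrop cl hcl).mono (by omega)
    refine ⟨X, fun i hi => by rw [hX i (by omega), extendBlock_of_lt hi], fun cl hcl => ?_⟩
    rw [satCounts, thresholdClauses, List.mem_append] at hcl
    obtain hcl | hcl := hcl
    · refine hsat cl ?_
      rwa [satCounts_congr g fun d hd =>
        (hdrop d hd).eval_congr fun i hi => extendBlock_of_lt hi]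
    · have hle : (cs.take k).countP (RawClause.eval x) ≤ k :=
        List.countP_le_length.trans (by simp)
      rw [(groupClauses_bounded hle hcs cl hcl).eval_congr hX]
      exact eval_extendBlock_group hcs cl hcl

/-! ### The gap of the gadget formulas -/

lemma exists_assignment {N : ℕ} (x : Fin N → Bool) : ∃ X : ℕ → Bool, ∀ i : Fin N, X i = x i :=
  ⟨fun i => if h : i < N then x ⟨i, h⟩ else false, fun i => by simp⟩

lemma gadgetSize_pos (k : ℕ) : 0 < gadgetSize k := by
  unfold gadgetSize
  omega

section gap

variable {k n N : ℕ} {φ : Formula n} {ψ : Formula N}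

lemma isYes_of_satCounts {g : ℕ} (hg : 0 < g) {X : ℕ → Bool}
    (hψ : ψ.map Clause.toRaw =
      thresholdClauses k n (satCounts k X g (φ.map Clause.toRaw)) (φ.map Clause.toRaw)) :
    IsYes 1 ψ := by
  have hlen : ψ.length = g * gadgetSize k := by
    rw [← List.length_map (f := Clause.toRaw), hψ, length_thresholdClauses, length_satCounts]
  have hpos : 0 < ψ.length := hlen ▸ Nat.mul_pos hg (gadgetSize_pos k)
  obtain ⟨Y, -, hsat⟩ := exists_eval_thresholdClauses (k := k) (o := n) X g
    (cs := φ.map Clause.toRaw) (by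
      intro cl hcl
      obtain ⟨c, -, rfl⟩ := List.mem_map.1 hcl
      exact c.toRaw_bounded)
  refine ⟨List.length_pos_iff.1 hpos, fun i => Y i, ?_⟩
  have hcount : ψ.countP (Clause.eval fun i => Y i) = ψ.length := by
    refine List.countP_eq_length.2 fun c hc => ?_
    rw [← Clause.eval_toRaw c (X := Y) fun i => rfl]
    exact hsat _ (hψ ▸ List.mem_map_of_mem hc)
  rw [satFraction, hcount, div_self (by positivity)]

/-- The total shortfall is at least `(P / Q - s) * φ.length`, and a violated gadget clause accounts
for at most `k` of it. Since there are at most `φ.length` groups, `ψ` has at most `φ.length *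
gadgetSize k` clauses, so the violated fraction is bounded below by a constant. -/
lemma isNo_of_thresholds {s : ℝ} {P Q : ℕ} (hQ : 0 < Q) (hs : s < P / Q) (hk : 0 < k)
    {ds : List ℕ} (hds : ∀ a ∈ ds, a ≤ k) (hpos : 0 < ds.length) (hle : ds.length ≤ φ.length)
    (hsum : P * φ.length ≤ Q * ds.sum)
    (hψ : ψ.map Clause.toRaw = thresholdClauses k n ds (φ.map Clause.toRaw)) (hφ : IsNo s φ) :
    IsNo (1 - (P / Q - s) / (k * gadgetSize k)) ψ := by
  have hlen : ψ.length = ds.length * gadgetSize k := by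
    rw [← List.length_map (f := Clause.toRaw), hψ, length_thresholdClauses]
  have hψpos : 0 < ψ.length := hlen ▸ Nat.mul_pos hpos (gadgetSize_pos k)
  refine ⟨List.length_pos_iff.1 hψpos, fun y => ?_⟩
  obtain ⟨Y, hY⟩ := exists_assignment y
  have hsat := hφ.2 fun i => Y i
  have hφpos : (0 : ℝ) < φ.length := by exact_mod_cast hpos.trans_le hle
  rw [satFraction, div_le_iff₀ hφpos, ← countP_toRaw φ (X := Y) fun i => rfl] at hsat
  have h1 := sum_le_countP_add (k := k) (o := n) Y ds hds (φ.map Clause.toRaw)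
  rw [← hψ] at h1
  have h2 : ψ.length = (ψ.map Clause.toRaw).countP (RawClause.eval Y) +
      (ψ.map Clause.toRaw).countP fun cl => !cl.eval Y := by
    rw [← List.length_map (f := Clause.toRaw) (as := ψ)]
    simpa using List.length_eq_countP_add_countP (RawClause.eval Y)
      (l := ψ.map Clause.toRaw)
  rw [countP_toRaw ψ hY] at h2
  generalize ((ψ.map Clause.toRaw).countP fun cl => !cl.eval Y) = U at h1 h2
  generalize (φ.map Clause.toRaw).countP (RawClause.eval Y) = V at h1 hsat
  have hK : (0 : ℝ) < gadgetSize k := by exact_mod_cast gadgetSize_pos k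
  have hk' : (0 : ℝ) < k := by exact_mod_cast hk
  have hQ' : (0 : ℝ) < Q := by exact_mod_cast hQ
  have hψpos' : (0 : ℝ) < ψ.length := by exact_mod_cast hψpos
  have h1' : (ds.sum : ℝ) ≤ V + k * U := by exact_mod_cast h1
  have hsum' : (P : ℝ) * φ.length ≤ Q * ds.sum := by exact_mod_cast hsum
  have hlen' : (ψ.length : ℝ) = ds.length * gadgetSize k := by exact_mod_cast hlen
  have hle' : (ds.length : ℝ) ≤ φ.length := by exact_mod_cast hle
  have h2' : (ψ.length : ℝ) = ψ.countP (Clause.eval y) + U := by exact_mod_cast h2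
  have h3 : (P / Q - s) * φ.length ≤ k * U := by
    have : (P / Q : ℝ) * φ.length ≤ ds.sum := by
      rw [div_mul_eq_mul_div, div_le_iff₀ hQ']
      linarith
    linarith
  have h4 : (P / Q - s) / (k * gadgetSize k) * ψ.length ≤ U := by
    rw [hlen', div_mul_eq_mul_div, div_le_iff₀ (by positivity)]
    have : (P / Q - s) * ds.length ≤ (P / Q - s) * φ.length :=
      mul_le_mul_of_nonneg_left hle' (by linarith)
    nlinarith
  rw [satFraction, div_le_iff₀ hψpos', sub_mul]
  linarith

end gap

/-! ### Blocks of binary digits -/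

/-- The values of `g` consecutive blocks of `b` binary digits. -/
def blockValues (b : ℕ) : ℕ → List Bool → List ℕ
  | 0, _ => []
  | g + 1, w => binValue (w.take b) :: blockValues b g (w.drop b)

lemma length_blockValues (b g : ℕ) (w : List Bool) : (blockValues b g w).length = g := by
  induction g generalizing w with
  | zero => rfl
  | succ g ih => simp [blockValues, ih]

lemma binValue_take_le (b : ℕ) (w : List Bool) : binValue (w.take b) ≤ 2 ^ b - 1 := by
  have h := binValue_lt (w.take b)
  have h' : 2 ^ (w.take b).length ≤ 2 ^ b := Nat.pow_le_pow_right (by omega) (by simp)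
  omega

lemma blockValues_le (b g : ℕ) (w : List Bool) : ∀ a ∈ blockValues b g w, a ≤ 2 ^ b - 1 := by
  induction g generalizing w with
  | zero => simp [blockValues]
  | succ g ih =>
    intro a ha
    rw [blockValues, List.mem_cons] at ha
    obtain rfl | ha := ha
    · exact binValue_take_le b w
    · exact ih _ a ha

lemma exists_blockValues_eq (b : ℕ) (ds : List ℕ) (h : ∀ a ∈ ds, a ≤ 2 ^ b - 1) :
    ∃ w : List Bool, w.length = b * ds.length ∧ blockValues b ds.length w = ds := by
  induction ds with
  | nil => exact ⟨[], by simp, rfl⟩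
  | cons a ds ih =>
    obtain ⟨w, hw, hv⟩ := ih fun d hd => h d (List.mem_cons_of_mem a hd)
    have ha := h a (by simp)
    obtain ⟨v, hv1, hv2⟩ := exists_binValue_eq b a (by have := Nat.two_pow_pos b; omega)
    refine ⟨v ++ w, by simp [hv1, hw]; ring, ?_⟩
    rw [List.length_cons, blockValues, List.take_left' hv1, List.drop_left' hv1, hv, hv2]

/-! ### The number of groups -/

/-- The number of groups of at most `k` clauses into which `m` clauses are divided. -/
def groupCount (k m : ℕ) : ℕ := (m + k - 1) / k

lemma groupCount_zero {k : ℕ} (hk : 0 < k) : groupCount k 0 = 0 :=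
  Nat.div_eq_of_lt (by omega)

lemma groupCount_pos_eq {k m : ℕ} (hk : 0 < k) (hm : 0 < m) :
    groupCount k m = groupCount k (m - k) + 1 := by
  unfold groupCount
  rcases le_total k m with h | h
  · rw [← Nat.add_div_right _ hk]
    congr 1
    omega
  · rw [Nat.sub_eq_zero_of_le h, Nat.div_eq_of_lt (a := 0 + k - 1) (by omega)]
    refine Nat.div_eq_of_lt_le ?_ ?_ <;> omega

lemma le_groupCount_mul {k : ℕ} (hk : 0 < k) (m : ℕ) : m ≤ groupCount k m * k := by
  have h := Nat.div_add_mod (m + k - 1) k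
  have h' := Nat.mod_lt (m + k - 1) hk
  rw [groupCount, mul_comm]
  omega

lemma groupCount_mul_le {k : ℕ} (m : ℕ) : groupCount k m * k ≤ m + k :=
  (Nat.div_mul_le_self _ _).trans (by omega)

lemma groupCount_le {k : ℕ} (hk : 0 < k) (m : ℕ) : groupCount k m ≤ m := by
  refine Nat.lt_succ_iff.1 ((Nat.div_lt_iff_lt_mul hk).2 ?_)
  nlinarith [Nat.sub_le (m + k) 1, Nat.mul_le_mul_left m hk, Nat.sub_lt (by omega : 0 < m + k) one_pos]

lemma groupCount_pos {k m : ℕ} (hk : 0 < k) (hm : 0 < m) : 0 < groupCount k m := by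
  rw [groupCount_pos_eq hk hm]
  omega

/-! ### Writing gadgets

The stacks of the subroutine are the first `B`. Of the others, stack `B` holds the clauses of the
input, `B + 1` a working copy of them, `B + 2` the number of variables, `B + 3` the offset of the
current block of variables, `B + 4` the digits of the current guess, `B + 5` a working copy of them,
`B + 6` temporary data, `B + 7` what remains of the required number of satisfied clauses,
`B + 8` that number, `B + 9` the number of clauses written, `B + 10` whether a run of the
subroutine has accepted, and `B + 11` and `B + 12` control loops. Numbers other than the guess
are in unary. -/

/-- Write the literal `l` of the current block on stack `0`. -/
def Prog.writeLiteral (B : ℕ) (l : RawLiteral) : Prog :=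
  .seq (.push 0 false) (.seq ((Prog.push 0 true).rep l.1)
    (.seq (.copy (B + 3) 0 (B + 6)) (.push 0 l.2)))

lemma runs_writeLiteral {B o : ℕ} (l : RawLiteral) {σ : Store} (hB : 0 < B)
    (ho : σ (B + 3) = List.replicate o true) (ht : σ (B + 6) = []) :
    Runs (.writeLiteral B l) σ (12 * (o + l.1) + 10)
      (Function.update σ 0 (RawLiteral.encode (o + l.1, l.2) ++ σ 0)) := by
  refine ((runs_push 0 false σ).seq ((runs_rep_push 0 true l.1 _).seq
    ((runs_copy (a := B + 3) (b := 0) (c := B + 6) (w := List.replicate o true) (by omega)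
      (by omega) (by omega) ?_ ?_).seq (runs_push 0 l.2 _)))).congr ?_ ?_
  · simp [ho]
  · simp [ht]
  · simp
    omega
  · simp [RawLiteral.encode, encodeNat, List.replicate_add, -List.replicate_append_replicate]

/-- Write the clause `cl` of the current block on stack `0`. -/
def Prog.writeClause (B : ℕ) (cl : RawClause) : Prog :=
  .seq (.writeLiteral B cl.2.2) (.seq (.writeLiteral B cl.2.1) (.writeLiteral B cl.1))

lemma runs_writeClause {B o V : ℕ} {cl : RawClause} {σ : Store} (hB : 0 < B)
    (ho : σ (B + 3) = List.replicate o true) (ht : σ (B + 6) = [])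
    (hcl : (cl.shift o).Bounded V) :
    Runs (.writeClause B cl) σ (36 * V + 32)
      (Function.update σ 0 ((cl.shift o).encode ++ σ 0)) := by
  obtain ⟨h1, h2, h3⟩ := hcl
  simp only [RawClause.shift] at h1 h2 h3
  refine ((runs_writeLiteral cl.2.2 hB ho ht).seq ((runs_writeLiteral cl.2.1 hB (o := o) ?_ ?_).seq
    (runs_writeLiteral cl.1 hB (o := o) ?_ ?_))).congr (by omega) ?_
  any_goals simp [ho]
  any_goals simp [ht]
  simp [RawClause.encode, RawClause.shift]

/-- Write clauses of the current block on stack `0`. -/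
def Prog.writeClauses (B : ℕ) : List RawClause → Prog
  | [] => .nop
  | cl :: cs => .seq (.writeClauses B cs) (.writeClause B cl)

lemma runs_writeClauses {B o V : ℕ} {cs : List RawClause} {σ : Store} (hB : 0 < B)
    (ho : σ (B + 3) = List.replicate o true) (ht : σ (B + 6) = [])
    (hcs : ∀ cl ∈ cs, (cl.shift o).Bounded V) :
    Runs (.writeClauses B cs) σ (cs.length * (36 * V + 33) + 1)
      (Function.update σ 0 (encodeClauses (cs.map (RawClause.shift o)) ++ σ 0)) := by
  induction cs with
  | nil => exact (runs_nop σ).congr (by simp) (by simp [encodeClauses])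
  | cons cl cs ih =>
    refine ((ih fun d hd => hcs d (List.mem_cons_of_mem cl hd)).seq
      (runs_writeClause (o := o) hB ?_ ?_ (hcs cl (by simp)))).congr ?_ ?_
    · simp [ho]
    · simp [ht]
    · rw [List.length_cons, add_mul]
      omega
    · simp [encodeClauses]

/-- Move a literal from the working copy of the input to stack `0`. -/
def Prog.copyLiteral (B : ℕ) : Prog :=
  .branch (B + 1)
    (.seq (.pop (B + 1)) (.seq (.push 0 false)
      (.seq (.readNat (B + 1) 0 (B + 12)) (.push 0 true))))
    (.seq (.pop (B + 1)) (.seq (.push 0 false)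
      (.seq (.readNat (B + 1) 0 (B + 12)) (.push 0 false))))
    .nop

lemma runs_copyLiteral {B : ℕ} {l : RawLiteral} {w : List Bool} {σ : Store}
    (hw : σ (B + 1) = l.encode ++ w) (hc : σ (B + 12) = []) :
    Runs (.copyLiteral B) σ (5 * l.1 + 17)
      (Function.update (Function.update σ (B + 1) w) 0 (l.encode ++ σ 0)) := by
  have h : ∀ b, l.2 = b → Runs (.seq (.pop (B + 1)) (.seq (.push 0 false)
      (.seq (.readNat (B + 1) 0 (B + 12)) (.push 0 b)))) σ (5 * l.1 + 16)
      (Function.update (Function.update σ (B + 1) w) 0 (l.encode ++ σ 0)) := by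
    rintro b rfl
    refine ((runs_pop (B + 1) σ).seq ((runs_push 0 false _).seq
      ((runs_readNat (a := B + 1) (b := 0) (c := B + 12) (i := l.1) (w := w) (by omega) (by omega)
        (by omega) ?_ ?_).seq (runs_push 0 l.2 _)))).congr (by omega) ?_
    · simp [hw, RawLiteral.encode]
    · simp [hc]
    · funext i
      simp only [Function.update_apply]
      split_ifs <;> simp_all [RawLiteral.encode, encodeNat]
  cases hl : l.2
  · exact .branch_false (w := encodeNat l.1 ++ w) (by simp [hw, RawLiteral.encode, hl]) (h _ hl)
  · exact .branch_true (w := encodeNat l.1 ++ w) (by simp [hw, RawLiteral.encode, hl]) (h _ hl)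

/-- Write the clauses that define the variables for the clause at position `c` of a group. -/
def Prog.writeLink (B c : ℕ) : Prog :=
  .seq (.copyLiteral B) (.seq (.writeLiteral B (tailVar c, true))
    (.seq (.writeLiteral B (satVar c, false)) (.seq (.copyLiteral B)
      (.seq (.copyLiteral B) (.writeLiteral B (tailVar c, false))))))

/-- A stack receives the last literal of a clause first, whereas the input clause is consumed from
its first literal on. This dictates the positions of `cl.1`, `cl.2.1` and `cl.2.2` in `linkClauses`.
-/
lemma runs_writeLink {B o c V : ℕ} {cl : RawClause} {w : List Bool} {σ : Store} (hB : 0 < B)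
    (ho : σ (B + 3) = List.replicate o true) (ht : σ (B + 6) = []) (hc : σ (B + 12) = [])
    (hw : σ (B + 1) = cl.encode ++ w) (hcl : cl.Bounded V) (hsat : o + satVar c < V)
    (htail : o + tailVar c < V) :
    Runs (.writeLink B c) σ (51 * V + 100) (Function.update (Function.update σ (B + 1) w) 0
      (encodeClauses (linkClauses o c cl) ++ σ 0)) := by
  obtain ⟨h1, h2, h3⟩ := hcl
  have hB1 : B ≠ 0 := hB.ne'
  refine ((runs_copyLiteral (l := cl.1) (w := RawLiteral.encode cl.2.1 ++
    (RawLiteral.encode cl.2.2 ++ w)) ?_ hc).seq ((runs_writeLiteral (tailVar c, true) hB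
      (o := o) ?_ ?_).seq ((runs_writeLiteral (satVar c, false) hB (o := o) ?_ ?_).seq
      ((runs_copyLiteral (l := cl.2.1) (w := RawLiteral.encode cl.2.2 ++ w) ?_ ?_).seq
      ((runs_copyLiteral (l := cl.2.2) (w := w) ?_ ?_).seq (runs_writeLiteral (tailVar c, false) hB
      (o := o) ?_ ?_)))))).congr ?_ ?_
  any_goals simp [ho]
  any_goals simp [ht]
  any_goals simp [hc]
  · simp [hw, RawClause.encode]
  · omega
  · funext i
    simp only [Function.update_apply]
    split_ifs <;> simp_all [encodeClauses, linkClauses, RawClause.encode]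

/-- Write the clauses for the clause at position `c` of a group. -/
def Prog.writeSlot (B k c : ℕ) : Prog :=
  .seq (.branch (B + 1) (.writeLink B c) (.writeLink B c) (.writeClauses B (missingClauses c)))
    (.writeClauses B (countClauses k c))

lemma runs_writeSlot {B k o c V : ℕ} {cs : List RawClause} {σ : Store} (hB : 0 < B) (hck : c < k)
    (ho : σ (B + 3) = List.replicate o true) (ht : σ (B + 6) = []) (hc : σ (B + 12) = [])
    (hw : σ (B + 1) = encodeClauses cs) (hcs : ∀ cl ∈ cs, cl.Bounded V)
    (hV : o + blockSize k ≤ V) :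
    Runs (.writeSlot B k c) σ ((2 * k + 4) * (36 * V + 33))
      (Function.update (Function.update σ (B + 1) (encodeClauses cs.tail)) 0
        (encodeClauses (slotClauses k o c cs.head?) ++ σ 0)) := by
  have hsat : satVar c < blockSize k := pair_lt_blockSize hck.le (by omega)
  have htail : tailVar c < blockSize k := pair_lt_blockSize hck.le (by omega)
  have hB1 : B ≠ 0 := hB.ne'
  have hcount : ∀ cl ∈ countClauses k c, (cl.shift o).Bounded V := fun cl hcl =>
    (countClauses_bounded hck cl hcl).shift.mono hV
  obtain _ | ⟨cl, cs⟩ := cs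
  · have hmiss : ∀ cl ∈ missingClauses c, (cl.shift o).Bounded V := fun cl hcl =>
      (missingClauses_bounded hck cl hcl).shift.mono hV
    refine ((Runs.branch_nil (by simpa [encodeClauses] using hw)
      (runs_writeClauses (V := V) hB ho ht hmiss)).seq
      (runs_writeClauses (V := V) (o := o) hB ?_ ?_ hcount)).congr ?_ ?_
    · simp [ho]
    · simp [ht]
    · rw [length_countClauses, add_mul]
      simp only [missingClauses, List.length_cons, List.length_nil]
      omega
    · funext i
      simp only [Function.update_apply]
      split_ifs <;> simp_all [encodeClauses, slotClauses]
  · have hlink := runs_writeLink (c := c) (V := V) (w := encodeClauses cs) hB ho ht hc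
      (by simpa [encodeClauses] using hw) (hcs cl (by simp)) (by omega) (by omega)
    have hbranch : Runs (.branch (B + 1) (.writeLink B c) (.writeLink B c)
        (.writeClauses B (missingClauses c))) σ (51 * V + 101) (Function.update (Function.update σ
          (B + 1) (encodeClauses cs)) 0 (encodeClauses (linkClauses o c cl) ++ σ 0)) := by
      cases hb : cl.1.2
      · refine .branch_false (w := encodeNat cl.1.1 ++ (RawLiteral.encode cl.2.1 ++
          (RawLiteral.encode cl.2.2 ++ encodeClauses cs))) ?_ hlink
        simp [hw, encodeClauses, RawClause.encode, RawLiteral.encode, hb]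
      · refine .branch_true (w := encodeNat cl.1.1 ++ (RawLiteral.encode cl.2.1 ++
          (RawLiteral.encode cl.2.2 ++ encodeClauses cs))) ?_ hlink
        simp [hw, encodeClauses, RawClause.encode, RawLiteral.encode, hb]
    refine (hbranch.seq (runs_writeClauses (V := V) (o := o) hB ?_ ?_ hcount)).congr ?_ ?_
    · simp [ho]
    · simp [ht]
    · rw [length_countClauses, add_mul]
      omega
    · funext i
      simp only [Function.update_apply]
      split_ifs <;> simp_all [encodeClauses, slotClauses]

/-- Write the clauses for the `r` positions of a group from position `c` on. -/
def Prog.writeSlots (B k c : ℕ) : ℕ → Prog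
  | 0 => .nop
  | r + 1 => .seq (.writeSlot B k c) (.writeSlots B k (c + 1) r)

lemma runs_writeSlots {B k o c r V : ℕ} {cs : List RawClause} {σ : Store} (hB : 0 < B)
    (hck : c + r ≤ k) (ho : σ (B + 3) = List.replicate o true) (ht : σ (B + 6) = [])
    (hc : σ (B + 12) = []) (hw : σ (B + 1) = encodeClauses cs) (hcs : ∀ cl ∈ cs, cl.Bounded V)
    (hV : o + blockSize k ≤ V) :
    Runs (.writeSlots B k c r) σ (r * ((2 * k + 4) * (36 * V + 33) + 1) + 1)
      (Function.update (Function.update σ (B + 1) (encodeClauses (cs.drop r))) 0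
        (encodeClauses (slotsClauses k o c r cs) ++ σ 0)) := by
  have hB1 : B ≠ 0 := hB.ne'
  induction r generalizing c cs σ with
  | zero =>
    refine (runs_nop σ).congr (by simp) ?_
    funext i
    simp only [Function.update_apply]
    split_ifs <;> simp_all [encodeClauses, slotsClauses]
  | succ r ih =>
    refine ((runs_writeSlot hB (by omega) ho ht hc hw hcs hV).seq (ih (c := c + 1) (cs := cs.tail)
      (by omega) ?_ ?_ ?_ ?_ fun cl hcl => hcs cl (List.mem_of_mem_tail hcl))).congr ?_ ?_
    any_goals simp [ho]
    any_goals simp [ht]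
    any_goals simp [hc]
    · generalize (2 * k + 4) * (36 * V + 33) = T
      rw [add_mul]
      omega
    · clear ih hcs ho ht hc hw hck hV
      funext i
      simp only [Function.update_apply]
      split_ifs <;> simp_all [encodeClauses, slotsClauses]

/-- Remove `b` bits from the working copy of the guess, and run the program that depends on
them. -/
def Prog.readBits (B : ℕ) : ℕ → (List Bool → Prog) → Prog
  | 0, f => f []
  | b + 1, f => .branch (B + 5)
      (.seq (.pop (B + 5)) (.readBits B b fun w => f (true :: w)))
      (.seq (.pop (B + 5)) (.readBits B b fun w => f (false :: w))) .nop

/-- The bits select one of finitely many programs, so a threshold becomes part of the finite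
control. This is possible because the block length is a constant of the program. -/
lemma runs_readBits {B : ℕ} {d e : List Bool} {f : List Bool → Prog} {σ σ' : Store} {t : ℕ}
    (he : σ (B + 5) = d ++ e) (hf : Runs (f d) (Function.update σ (B + 5) e) t σ') :
    Runs (.readBits B d.length f) σ (3 * d.length + t) σ' := by
  induction d generalizing f σ with
  | nil =>
    have : Function.update σ (B + 5) e = σ := by
      rw [← show σ (B + 5) = e by simpa using he, Function.update_eq_self]
    rw [this] at hf
    exact hf.mono (by simp)
  | cons x d ih =>
    have h := (runs_pop (B + 5) σ).seq (ih (f := fun w => f (x :: w))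
      (σ := Function.update σ (B + 5) (σ (B + 5)).tail) (by simp [he]) (by simpa using hf))
    have he' : σ (B + 5) = x :: (d ++ e) := by simpa using he
    cases x
    · exact (Runs.branch_false he' h).mono (by simp; omega)
    · exact (Runs.branch_true he' h).mono (by simp; omega)

/-- Write the gadget for the next group of `k` clauses with the next threshold, and count down by
`Q` times the threshold. -/
def Prog.writeGroup (B b Q : ℕ) : Prog :=
  .seq (.readBits B b fun d => .seq (.writeClause B (startClause (binValue d)))
      ((Prog.pop (B + 7)).rep (Q * binValue d)))
    (.seq (.writeClauses B (finalClauses (2 ^ b - 1)))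
      (.seq (.writeSlots B (2 ^ b - 1) 0 (2 ^ b - 1))
        (.seq ((Prog.push (B + 3) true).rep (blockSize (2 ^ b - 1)))
          ((Prog.push (B + 9) true).rep (gadgetSize (2 ^ b - 1))))))

/-- The constant `A` depends only on the program, while `V` bounds all variable indices. As numbers
are in unary, writing a constant number of clauses costs `O(V)` steps. -/
lemma exists_runs_writeGroup (B b Q : ℕ) (hB : 0 < B) :
    ∃ A : ℕ, ∀ (k o p m V : ℕ) (cs : List RawClause) (d e : List Bool) (σ : Store),
      k = 2 ^ b - 1 → d.length = b → σ (B + 3) = List.replicate o true → σ (B + 6) = [] →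
      σ (B + 12) = [] → σ (B + 1) = encodeClauses cs → (∀ cl ∈ cs, cl.Bounded V) →
      o + blockSize k ≤ V → σ (B + 5) = d ++ e → σ (B + 7) = List.replicate p true →
      σ (B + 9) = List.replicate m true →
      Runs (.writeGroup B b Q) σ (A * V)
        (Function.update (Function.update (Function.update (Function.update (Function.update
          (Function.update σ (B + 5) e)
          (B + 7) (List.replicate (p - Q * binValue d) true))
          0 (encodeClauses (groupClauses k o (binValue d) cs) ++ σ 0))
          (B + 1) (encodeClauses (cs.drop k)))
          (B + 3) (List.replicate (o + blockSize k) true))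
          (B + 9) (List.replicate (m + gadgetSize k) true)) := by
  -- The summands bound the stages of the program; the factors `69` come from `36 * V + 33 ≤ 69 *
  -- V`, valid as `1 ≤ V`.
  refine ⟨100 + 3 * b + 2 * Q * 2 ^ b + (2 ^ b - 1) * 69 + (2 ^ b - 1) * ((2 * (2 ^ b - 1) + 4) *
    69 + 1) + 2 * blockSize (2 ^ b - 1) + 2 * gadgetSize (2 ^ b - 1), ?_⟩
  rintro k o p m V cs d e σ rfl rfl ho ht hc hw hcs hV he hp hm
  have hB1 : B ≠ 0 := hB.ne'
  have hV1 : 1 ≤ V := by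
    have : 0 < blockSize (2 ^ d.length - 1) := by unfold blockSize; positivity
    omega
  have ha : binValue d ≤ 2 ^ d.length - 1 := by
    have := binValue_lt d
    omega
  have hfinal : ∀ cl ∈ finalClauses (2 ^ d.length - 1), (cl.shift o).Bounded V := fun cl hcl =>
    (finalClauses_bounded _ cl hcl).shift.mono hV
  refine ((runs_readBits he ((runs_writeClause (o := o) (V := V) hB ?_ ?_
    ((startClause_bounded ha).shift.mono hV)).seq (runs_rep_pop _ _ _))).seq
    ((runs_writeClauses (o := o) (V := V) hB ?_ ?_ hfinal).seq
    ((runs_writeSlots (o := o) (V := V) (cs := cs) hB (by omega) ?_ ?_ ?_ ?_ hcs hV).seq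
    ((runs_rep_push _ _ _ _).seq (runs_rep_push _ _ _ _))))).congr ?_ ?_
  any_goals simp [ho]
  any_goals simp [ht]
  any_goals simp [hc]
  any_goals simp [hw]
  · have hQ : Q * binValue d ≤ Q * 2 ^ d.length :=
      Nat.mul_le_mul_left Q (by have := binValue_lt d; omega)
    simp only [finalClauses, List.length_map, List.length_range]
    generalize 2 ^ d.length - 1 = k
    have hle : 36 * V + 33 ≤ 69 * V := by omega
    have h1 : k * (36 * V + 33) ≤ k * 69 * V := by
      rw [mul_assoc]
      exact Nat.mul_le_mul_left _ hle
    have h2 : k * ((2 * k + 4) * (36 * V + 33) + 1) ≤ k * ((2 * k + 4) * 69 + 1) * V := by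
      rw [mul_assoc]
      refine Nat.mul_le_mul_left _ ?_
      have h := Nat.mul_le_mul_left (2 * k + 4) hle
      rw [← mul_assoc] at h
      rw [add_mul ((2 * k + 4) * 69) 1 V]
      omega
    have h3 : ∀ x : ℕ, x ≤ x * V := fun x => Nat.le_mul_of_pos_right x hV1
    have h4 := h3 (3 * d.length)
    have h5 := h3 (2 * Q * 2 ^ d.length)
    have h6 := h3 (2 * blockSize k)
    have h7 := h3 (2 * gadgetSize k)
    have h8 : 2 * (Q * binValue d) ≤ 2 * Q * 2 ^ d.length := by
      rw [mul_assoc]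
      omega
    calc _ ≤ 100 * V + 3 * d.length * V + 2 * Q * 2 ^ d.length * V + k * 69 * V +
        k * ((2 * k + 4) * 69 + 1) * V + 2 * blockSize k * V + 2 * gadgetSize k * V := by omega
      _ = _ := by ring
  · clear hfinal hcs hV hV1 ha ho ht hc
    funext i
    simp only [Function.update_apply]
    split_ifs <;> simp_all [encodeClauses, groupClauses, Nat.add_comm (gadgetSize _),
      Nat.add_comm (blockSize _)]

lemma exists_runs_loop_writeGroup (B b Q : ℕ) (hB : 0 < B) (hb : 0 < b) :
    ∃ A : ℕ, ∀ (k g o p m V : ℕ) (cs : List RawClause) (w : List Bool) (σ : Store),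
      k = 2 ^ b - 1 → w.length = b * g → σ (B + 3) = List.replicate o true → σ (B + 6) = [] →
      σ (B + 12) = [] → σ (B + 1) = encodeClauses cs → (∀ cl ∈ cs, cl.Bounded V) →
      o + g * blockSize k ≤ V → σ (B + 5) = w → σ (B + 7) = List.replicate p true →
      σ (B + 9) = List.replicate m true →
      Runs (.loop (B + 5) (.writeGroup B b Q)) σ (g * (A * V + 1) + 1)
        (Function.update (Function.update (Function.update (Function.update (Function.update
          (Function.update σ (B + 5) [])
          (B + 7) (List.replicate (p - Q * (blockValues b g w).sum) true))
          0 (encodeClauses (thresholdClauses k o (blockValues b g w) cs) ++ σ 0))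
          (B + 1) (encodeClauses (cs.drop (g * k))))
          (B + 3) (List.replicate (o + g * blockSize k) true))
          (B + 9) (List.replicate (m + g * gadgetSize k) true)) := by
  obtain ⟨A, hA⟩ := exists_runs_writeGroup B b Q hB
  refine ⟨A, ?_⟩
  intro k g
  have hB1 : B ≠ 0 := hB.ne'
  induction g with
  | zero =>
    intro o p m V cs w σ hk hw ho ht hc hcs hbd hV he hp hm
    obtain rfl : w = [] := List.length_eq_zero_iff.1 (by simpa using hw)
    refine (runs_loop_nil he).congr (by omega) ?_
    clear hA hbd
    funext i
    simp only [Function.update_apply]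
    split_ifs <;> simp_all [blockValues, thresholdClauses, encodeClauses]
  | succ g ih =>
    intro o p m V cs w σ hk hw ho ht hc hcs hbd hV he hp hm
    have hlen : (w.take b).length = b := by
      rw [List.length_take, hw, Nat.mul_succ]
      omega
    have hlen' : (w.drop b).length = b * g := by
      rw [List.length_drop, hw, Nat.mul_succ]
      omega
    rw [Nat.succ_mul] at hV
    have hne : σ (B + 5) ≠ [] := by
      rw [he, ← List.length_pos_iff, hw]
      positivity
    refine (Runs.loop hne (hA k o p m V cs (w.take b) (w.drop b) σ hk hlen ho ht hc hcs hbd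
      (by omega) (by rw [he, List.take_append_drop]) hp hm)
      (ih (o + blockSize k) (p - Q * binValue (w.take b)) (m + gadgetSize k) V (cs.drop k)
        (w.drop b) _ hk hlen' ?_ ?_ ?_ ?_ (fun cl hcl => hbd cl (List.mem_of_mem_drop hcl))
        (by omega) ?_ ?_ ?_)).congr ?_ ?_
    any_goals simp
    any_goals simp [ht]
    any_goals simp [hc]
    · rw [Nat.succ_mul]
      omega
    · clear ih hA hbd hne hlen hlen' ho ht hc hcs he hp hm hw
      -- Truncated subtraction can be done in instalments, so the counter ends empty exactly if `Q`
      -- times the sum of all thresholds reaches its initial value.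
      have e1 : p - Q * binValue (w.take b) - Q * (blockValues b g (w.drop b)).sum =
          p - Q * (binValue (w.take b) + (blockValues b g (w.drop b)).sum) := by
        rw [mul_add]
        omega
      have e2 : k + g * k = (g + 1) * k := by ring
      have e3 : o + blockSize k + g * blockSize k = o + (g + 1) * blockSize k := by ring
      have e4 : m + gadgetSize k + g * gadgetSize k = m + (g + 1) * gadgetSize k := by ring
      rw [e1, e2, e3, e4]
      funext i
      simp only [Function.update_apply]
      split_ifs <;> simp_all [blockValues, thresholdClauses, encodeClauses]

/-! ### Trying a guess -/

/-- The stack contents between two guesses, and when the subroutine is called. -/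
def loopStore (B : ℕ) (low : Store) (data vars guess rest goal flag ctrl : List Bool) : Store :=
  mergeStore B (fun r => match r - B with
    | 0 => data
    | 2 => vars
    | 4 => guess
    | 7 => rest
    | 8 => goal
    | 10 => flag
    | 11 => ctrl
    | _ => []) low

section loopStore

variable {B : ℕ} (low : Store) (data vars guess rest goal flag ctrl w : List Bool)

lemma loopStore_of_lt {r : ℕ} (h : r < B) :
    loopStore B low data vars guess rest goal flag ctrl r = low r := mergeStore_of_lt _ _ h

lemma loopStore_add (j : ℕ) : loopStore B low data vars guess rest goal flag ctrl (B + j) =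
    match j with
    | 0 => data
    | 2 => vars
    | 4 => guess
    | 7 => rest
    | 8 => goal
    | 10 => flag
    | 11 => ctrl
    | _ => [] := by
  rw [loopStore, mergeStore_of_le _ _ (by omega), Nat.add_sub_cancel_left]

lemma loopStore_guess :
    loopStore B low data vars guess rest goal flag ctrl (B + 4) = guess :=
  loopStore_add _ _ _ _ _ _ _ _ 4

lemma loopStore_rest :
    loopStore B low data vars guess rest goal flag ctrl (B + 7) = rest :=
  loopStore_add _ _ _ _ _ _ _ _ 7

lemma loopStore_flag :
    loopStore B low data vars guess rest goal flag ctrl (B + 10) = flag :=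
  loopStore_add _ _ _ _ _ _ _ _ 10

lemma loopStore_ctrl :
    loopStore B low data vars guess rest goal flag ctrl (B + 11) = ctrl :=
  loopStore_add _ _ _ _ _ _ _ _ 11

lemma eq_loopStore {σ : Store} (h : ∀ r < B, σ r = low r)
    (h' : ∀ j, σ (B + j) = loopStore B low data vars guess rest goal flag ctrl (B + j)) :
    σ = loopStore B low data vars guess rest goal flag ctrl := by
  funext r
  rcases lt_or_ge r B with hr | hr
  · rw [h r hr, loopStore_of_lt _ _ _ _ _ _ _ _ hr]
  · obtain ⟨j, rfl⟩ := Nat.exists_eq_add_of_le hr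
    exact h' j

lemma update_loopStore_guess : Function.update (loopStore B low data vars guess rest goal flag ctrl)
    (B + 4) w = loopStore B low data vars w rest goal flag ctrl := by
  refine eq_loopStore _ _ _ _ _ _ _ _ (fun r hr => ?_) fun j => ?_
  · rw [Function.update_of_ne (by omega), loopStore_of_lt _ _ _ _ _ _ _ _ hr]
  · by_cases hj : j = 4
    · subst hj
      simp [loopStore_add]
    · rw [Function.update_of_ne (by omega), loopStore_add, loopStore_add]
      split <;> first | rfl | contradiction

lemma update_loopStore_rest : Function.update (loopStore B low data vars guess rest goal flag ctrl)
    (B + 7) w = loopStore B low data vars guess w goal flag ctrl := by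
  refine eq_loopStore _ _ _ _ _ _ _ _ (fun r hr => ?_) fun j => ?_
  · rw [Function.update_of_ne (by omega), loopStore_of_lt _ _ _ _ _ _ _ _ hr]
  · by_cases hj : j = 7
    · subst hj
      simp [loopStore_add]
    · rw [Function.update_of_ne (by omega), loopStore_add, loopStore_add]
      split <;> first | rfl | contradiction

lemma update_loopStore_flag : Function.update (loopStore B low data vars guess rest goal flag ctrl)
    (B + 10) w = loopStore B low data vars guess rest goal w ctrl := by
  refine eq_loopStore _ _ _ _ _ _ _ _ (fun r hr => ?_) fun j => ?_
  · rw [Function.update_of_ne (by omega), loopStore_of_lt _ _ _ _ _ _ _ _ hr]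
  · by_cases hj : j = 10
    · subst hj
      simp [loopStore_add]
    · rw [Function.update_of_ne (by omega), loopStore_add, loopStore_add]
      split <;> first | rfl | contradiction

lemma update_loopStore_ctrl : Function.update (loopStore B low data vars guess rest goal flag ctrl)
    (B + 11) w = loopStore B low data vars guess rest goal flag w := by
  refine eq_loopStore _ _ _ _ _ _ _ _ (fun r hr => ?_) fun j => ?_
  · rw [Function.update_of_ne (by omega), loopStore_of_lt _ _ _ _ _ _ _ _ hr]
  · by_cases hj : j = 11
    · subst hj
      simp [loopStore_add]
    · rw [Function.update_of_ne (by omega), loopStore_add, loopStore_add]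
      split <;> first | rfl | contradiction

lemma mergeStore_loopStore (low' : Store) :
    mergeStore B (loopStore B low data vars guess rest goal flag ctrl) low' =
      loopStore B low' data vars guess rest goal flag ctrl := by
  refine eq_loopStore _ _ _ _ _ _ _ _ (fun r hr => mergeStore_of_lt _ _ hr) fun j => ?_
  rw [mergeStore_of_le _ _ (by omega), loopStore_add, loopStore_add]

end loopStore

/-! ### The input of the subroutine -/

lemma length_encodeClauses_le {V : ℕ} {cs : List RawClause} (h : ∀ cl ∈ cs, cl.Bounded V) :
    (encodeClauses cs).length ≤ cs.length * (3 * V + 3) := by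
  induction cs with
  | nil => simp [encodeClauses]
  | cons cl cs ih =>
    obtain ⟨h1, h2, h3⟩ := h cl (by simp)
    have h4 := ih fun d hd => h d (List.mem_cons_of_mem cl hd)
    rw [List.length_cons, add_mul, encodeClauses, List.flatMap_cons, List.length_append,
      RawClause.encode]
    rw [encodeClauses] at h4
    simp only [RawLiteral.encode, encodeNat, List.length_append, List.length_cons,
      List.length_replicate, List.length_nil]
    omega

/-- The encoding of the gadget formula for a guess. -/
def guessInput (b n g : ℕ) (cs : List RawClause) (w : List Bool) : List Bool :=
  encodeNat (n + g * blockSize (2 ^ b - 1)) ++ encodeNat (g * gadgetSize (2 ^ b - 1)) ++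
    encodeClauses (thresholdClauses (2 ^ b - 1) n (blockValues b g w.reverse) cs)

lemma length_guessInput_le {b n g V : ℕ} {cs : List RawClause} (hcs : ∀ cl ∈ cs, cl.Bounded n)
    (hV : n + g * blockSize (2 ^ b - 1) ≤ V) (hg : g ≤ V) (hV1 : 1 ≤ V) (w : List Bool) :
    (guessInput b n g cs w).length ≤ (7 * gadgetSize (2 ^ b - 1) + 3) * (V * V) := by
  have hbd := thresholdClauses_bounded (o := n) (blockValues_le b g w.reverse) hcs
  rw [length_blockValues] at hbd
  have h := length_encodeClauses_le fun cl hcl => (hbd cl hcl).mono hV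
  rw [length_thresholdClauses, length_blockValues] at h
  rw [guessInput]
  simp only [encodeNat, List.length_append, List.length_replicate, List.length_singleton]
  generalize gadgetSize (2 ^ b - 1) = K at *
  have hVV : V ≤ V * V := Nat.le_mul_of_pos_left V hV1
  have h1 : g * K ≤ K * (V * V) := by
    rw [mul_comm]
    exact Nat.mul_le_mul_left K (hg.trans hVV)
  have h2 : g * K * (3 * V + 3) ≤ 6 * (K * (V * V)) := by
    calc g * K * (3 * V + 3) ≤ V * K * (6 * V) :=
          Nat.mul_le_mul (Nat.mul_le_mul_right K hg) (by omega)
      _ = _ := by ring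
  calc _ ≤ 7 * (K * (V * V)) + 3 * (V * V) := by omega
    _ = _ := by ring

/-- Write the input of the subroutine for the current guess. -/
def Prog.build (B b Q : ℕ) : Prog :=
  .seq (.copy (B + 4) (B + 5) (B + 6)) (.seq (.copy B (B + 1) (B + 6))
    (.seq (.copy (B + 2) (B + 3) (B + 6)) (.seq (.copy (B + 8) (B + 7) (B + 6))
    (.seq (.loop (B + 5) (.writeGroup B b Q)) (.seq (.push 0 false) (.seq (.move (B + 9) 0)
    (.seq (.push 0 false) (.move (B + 3) 0))))))))

/-- Copying reverses: the clauses are kept reversed and so are read in their order, whereas the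
guess `w` is read as `w.reverse`. The formula is written back to front, so the two numbers of its
header come last. -/
lemma exists_runs_build (B b Q : ℕ) (hB : 0 < B) (hb : 0 < b) :
    ∃ A : ℕ, ∀ (n g R V : ℕ) (cs : List RawClause) (w flag ctrl : List Bool),
      w.length = b * g → (∀ cl ∈ cs, cl.Bounded n) → cs.length ≤ g * (2 ^ b - 1) →
      n + g * blockSize (2 ^ b - 1) ≤ V → g ≤ V → cs.length ≤ V → 1 ≤ V →
      Runs (.build B b Q) (loopStore B (fun _ => []) (encodeClauses cs).reverse
        (List.replicate n true) w [] (List.replicate R true) flag ctrl) (A * (V * V) + 12 * R)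
        (loopStore B (inputStore (guessInput b n g cs w)) (encodeClauses cs).reverse
        (List.replicate n true) w
        (List.replicate (R - Q * (blockValues b g w.reverse).sum) true) (List.replicate R true)
        flag ctrl) := by
  obtain ⟨A, hA⟩ := exists_runs_loop_writeGroup B b Q hB hb
  refine ⟨12 * b + A + 5 * gadgetSize (2 ^ b - 1) + 200, ?_⟩
  intro n g R V cs w flag ctrl hw hcs hlen hV hg hm hV1
  have hB1 : B ≠ 0 := hB.ne'
  have hloop := hA (2 ^ b - 1) g n R 0 V cs w.reverse
  have hdata := loopStore_add (B := B) (fun _ => []) (encodeClauses cs).reverse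
        (List.replicate n true) w [] (List.replicate R true) flag ctrl 0
  rw [Nat.add_zero] at hdata
  refine ((runs_copy (w := w) (by omega) (by omega) (by omega) (loopStore_add _ _ _ _ _ _ _ _ 4)
      (loopStore_add _ _ _ _ _ _ _ _ 6)).seq
    ((runs_copy (w := (encodeClauses cs).reverse) (by omega) (by omega) (by omega) ?_ ?_).seq
    ((runs_copy (w := List.replicate n true) (by omega) (by omega) (by omega) ?_ ?_).seq
    ((runs_copy (w := List.replicate R true) (by omega) (by omega) (by omega) ?_ ?_).seq
    ((hloop _ rfl (by simp [hw]) ?_ ?_ ?_ ?_ (fun cl hcl => (hcs cl hcl).mono (by omega)) hV ?_ ?_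
      ?_).seq
    ((runs_push _ _ _).seq ((runs_move (w := List.replicate (g * gadgetSize (2 ^ b - 1)) true)
      (by omega) ?_).seq
    ((runs_push _ _ _).seq (runs_move (w := List.replicate (n + g * blockSize (2 ^ b - 1)) true)
      (by omega) ?_))))))))).congr ?_ ?_
  any_goals simp [loopStore_add]
  · exact hdata
  · have hd := length_encodeClauses_le hcs
    have hVV : V ≤ V * V := Nat.le_mul_of_pos_left V hV1
    have hd' : cs.length * (3 * n + 3) ≤ 6 * (V * V) := by
      calc cs.length * (3 * n + 3) ≤ V * (6 * V) := Nat.mul_le_mul hm (by omega)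
        _ = _ := by ring
    have h1 : b * g ≤ b * (V * V) := Nat.mul_le_mul_left b (hg.trans hVV)
    have h2 : g * gadgetSize (2 ^ b - 1) ≤ gadgetSize (2 ^ b - 1) * (V * V) := by
      rw [mul_comm]
      exact Nat.mul_le_mul_left _ (hg.trans hVV)
    have h3 : g * (A * V + 1) ≤ A * (V * V) + V * V := by
      calc g * (A * V + 1) ≤ V * (A * V + 1) := Nat.mul_le_mul_right _ hg
        _ ≤ _ := by nlinarith
    rw [hw]
    calc _ ≤ 12 * (b * (V * V)) + A * (V * V) + 5 * (gadgetSize (2 ^ b - 1) * (V * V)) +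
          200 * (V * V) + 12 * R := by omega
      _ = _ := by ring
  · refine eq_loopStore _ _ _ _ _ _ _ _ (fun r hr => ?_) fun j => ?_
    · by_cases h : r = 0
      · subst h
        simp [loopStore_of_lt _ _ _ _ _ _ _ _ hr, inputStore, guessInput, encodeNat]
      · have hne : ∀ j, r ≠ B + j := fun j => by omega
        simp [loopStore_of_lt _ _ _ _ _ _ _ _ hr, inputStore, h, hne]
    · simp [Function.update_apply, loopStore_add, List.drop_eq_nil_of_le hlen, hB1]
      split_ifs <;> (subst_vars; simp [encodeClauses])
      split <;> first | rfl | contradiction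

/-- Run the subroutine `p` if the guess promises enough satisfied clauses, and record whether it has
accepted. -/
def Prog.runIfEnough (B : ℕ) (p : Prog) : Prog :=
  .branch (B + 7) .nop .nop (.seq p (.branch 1 (.push (B + 10) true) .nop .nop))

/-- Try the current guess, and proceed to the next guess. -/
def Prog.tryGuess (B b Q : ℕ) (p : Prog) : Prog :=
  .seq (.build B b Q) (.seq (.runIfEnough B p) (.seq (.clearBelow B) (.seq (.clear (B + 7))
    (.increment (B + 4) (B + 6) (B + 12) (B + 11)))))

/-- The predicate `F` on the flag is left open, so that one statement serves for halting, for
rejection and for acceptance. -/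
lemma reaches_runIfEnough {B : ℕ} {p : Prog} (hB : 1 < B) (hp : p.Below B) {q : ℝ≥0∞}
    (hq : q ≤ 1) {t : ℕ} {input data vars w rest goal flag ctrl : List Bool}
    {F : List Bool → Prop}
    (hrun : rest = [] → Reaches q p (inputStore input) t fun σ =>
      (Accepting σ → F (true :: flag)) ∧ (¬ Accepting σ → F flag))
    (hskip : rest ≠ [] → F flag) :
    Reaches q (.runIfEnough B p)
      (loopStore B (inputStore input) data vars w rest goal flag ctrl) (t + 4) fun σ =>
      ∃ low flag', F flag' ∧ lowSize B low ≤ input.length + t ∧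
        σ = loopStore B low data vars w rest goal flag' ctrl := by
  have hrest : loopStore B (inputStore input) data vars w rest goal flag ctrl (B + 7) = rest :=
    loopStore_rest _ _ _ _ _ _ _ _
  have hnop : rest ≠ [] → Reaches q .nop
      (loopStore B (inputStore input) data vars w rest goal flag ctrl) (t + 3) fun σ =>
      ∃ low flag', F flag' ∧ lowSize B low ≤ input.length + t ∧
        σ = loopStore B low data vars w rest goal flag' ctrl := fun h =>
    ((runs_nop _).mono (by omega)).reaches (S := fun σ => ∃ low flag', F flag' ∧
        lowSize B low ≤ input.length + t ∧ σ = loopStore B low data vars w rest goal flag' ctrl)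
      ⟨inputStore input, flag, hskip h, (lowSize_inputStore B input).trans (by omega), rfl⟩
      |>.mono hq le_rfl fun _ => id
  rcases hr : rest with _ | ⟨_ | _, l⟩
  · have h := (hrun hr).mergeStore hp (loopStore B (inputStore input) data vars w rest goal flag ctrl)
    rw [mergeStore_loopStore] at h
    subst hr
    refine reaches_branch_nil hrest ?_
    rw [← mul_one q]
    refine Reaches.mono (Reaches.seq h (q' := 1) (u := 2) ?_) le_rfl le_rfl fun _ => id
    rintro _ ⟨low, rfl, ⟨hacc, hrej⟩, hsize⟩
    rw [mergeStore_loopStore]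
    have h1 : loopStore B low data vars w [] goal flag ctrl 1 = low 1 :=
      loopStore_of_lt _ _ _ _ _ _ _ _ hB
    rcases h2 : low 1 with _ | ⟨_ | _, l⟩
    · exact reaches_branch_nil (h1.trans h2) ((runs_nop _).reaches
        ⟨low, flag, hrej (by simp [Accepting, h2]), hsize, rfl⟩)
    · exact reaches_branch_false (h1.trans h2) ((runs_nop _).reaches
        ⟨low, flag, hrej (by simp [Accepting, h2]), hsize, rfl⟩)
    · refine reaches_branch_true (h1.trans h2) ((runs_push _ _ _).reaches
        ⟨low, true :: flag, hacc (by simp [Accepting, h2]), hsize, ?_⟩)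
      rw [update_loopStore_flag, loopStore_flag]
  · rw [← hr]
    exact reaches_branch_false (hrest.trans hr) (hnop (by simp [hr]))
  · rw [← hr]
    exact reaches_branch_true (hrest.trans hr) (hnop (by simp [hr]))

lemma exists_reaches_tryGuess (B b Q : ℕ) (p : Prog) (hB : 1 < B) (hp : p.Below B) (hb : 0 < b) :
    ∃ A : ℕ, ∀ (n g R V t : ℕ) (cs : List RawClause) (w flag : List Bool) (q : ℝ≥0∞)
      (F : List Bool → Prop), q ≤ 1 →
      w.length = b * g → (∀ cl ∈ cs, cl.Bounded n) → cs.length ≤ g * (2 ^ b - 1) →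
      n + g * blockSize (2 ^ b - 1) ≤ V → g ≤ V → cs.length ≤ V → 1 ≤ V →
      (R ≤ Q * (blockValues b g w.reverse).sum →
        Reaches q p (inputStore (guessInput b n g cs w)) t fun σ =>
          (Accepting σ → F (true :: flag)) ∧ (¬ Accepting σ → F flag)) →
      (¬ R ≤ Q * (blockValues b g w.reverse).sum → F flag) →
      Reaches q (.tryGuess B b Q p) (loopStore B (fun _ => []) (encodeClauses cs).reverse
        (List.replicate n true) w [] (List.replicate R true) flag [true])
        (A * (V * V) + 14 * R + 3 * t) fun σ => ∃ flag', F flag' ∧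
          (binValue w + 1 = 2 ^ w.length → ∃ w', σ = loopStore B (fun _ => [])
            (encodeClauses cs).reverse (List.replicate n true) w' [] (List.replicate R true)
            flag' []) ∧
          (binValue w + 1 < 2 ^ w.length → ∃ w', w'.length = w.length ∧
            binValue w' = binValue w + 1 ∧ σ = loopStore B (fun _ => [])
            (encodeClauses cs).reverse (List.replicate n true) w' [] (List.replicate R true)
            flag' [true]) := by
  obtain ⟨A, hA⟩ := exists_runs_build B b Q (by omega) hb
  -- The subroutine takes `t` steps and leaves at most `t` bits more than its input, each erased in
  -- two steps; hence `3 * t`. Likewise `14 * R` is the cost of copying the goal and clearing its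
  -- remainder.
  refine ⟨A + 2 * (7 * gadgetSize (2 ^ b - 1) + 3) + 2 * B + 9 * b + 40, ?_⟩
  intro n g R V t cs w flag q F hq hw hcs hlen hV hg hm hV1 hrun hskip
  have hbuild := hA n g R V cs w flag [true] hw hcs hlen hV hg hm hV1
  have hinput := length_guessInput_le hcs hV hg hV1 w
  have hnil : List.replicate (R - Q * (blockValues b g w.reverse).sum) true = [] ↔
      R ≤ Q * (blockValues b g w.reverse).sum := by
    rw [List.replicate_eq_nil_iff]
    omega
  have hcheck := reaches_runIfEnough (data := (encodeClauses cs).reverse)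
    (vars := List.replicate n true) (w := w)
    (rest := List.replicate (R - Q * (blockValues b g w.reverse).sum) true)
    (goal := List.replicate R true) (ctrl := [true]) hB hp hq
    (fun h => hrun (hnil.1 h)) (fun h => hskip (mt hnil.2 h))
  rw [← mul_one q] at hcheck ⊢
  have hseq := hbuild.seq_reaches (Reaches.seq (by simpa using hcheck) (q' := 1)
    (u := 2 * ((7 * gadgetSize (2 ^ b - 1) + 3) * (V * V) + t) + 2 * B + 2 * R + 9 * (b * g) + 25)
    (p' := .seq (.clearBelow B) (.seq (.clear (B + 7))
      (.increment (B + 4) (B + 6) (B + 12) (B + 11))))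
    (S' := fun σ => ∃ flag', F flag' ∧
          (binValue w + 1 = 2 ^ w.length → ∃ w', σ = loopStore B (fun _ => [])
            (encodeClauses cs).reverse (List.replicate n true) w' [] (List.replicate R true)
            flag' []) ∧
          (binValue w + 1 < 2 ^ w.length → ∃ w', w'.length = w.length ∧
            binValue w' = binValue w + 1 ∧ σ = loopStore B (fun _ => [])
            (encodeClauses cs).reverse (List.replicate n true) w' [] (List.replicate R true)
            flag' [true])) ?_)
  · refine Reaches.mono hseq le_rfl ?_ fun _ => id
    have hVV : V ≤ V * V := Nat.le_mul_of_pos_left V hV1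
    have h1 : b * g ≤ b * (V * V) := Nat.mul_le_mul_left b (hg.trans hVV)
    have h2 : B ≤ B * (V * V) := Nat.le_mul_of_pos_right B (by omega)
    calc _ ≤ A * (V * V) + 2 * ((7 * gadgetSize (2 ^ b - 1) + 3) * (V * V)) + 2 * (B * (V * V)) +
          9 * (b * (V * V)) + 40 * (V * V) + 14 * R + 3 * t := by omega
      _ = _ := by ring
  · rintro _ ⟨low, flag', hF, hsize, rfl⟩
    have hclear := runs_clearBelow B (loopStore B low (encodeClauses cs).reverse
      (List.replicate n true) w (List.replicate (R - Q * (blockValues b g w.reverse).sum) true)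
      (List.replicate R true) flag' [true])
    have hlow : lowSize B (loopStore B low (encodeClauses cs).reverse
      (List.replicate n true) w (List.replicate (R - Q * (blockValues b g w.reverse).sum) true)
      (List.replicate R true) flag' [true]) = lowSize B low :=
      Finset.sum_congr rfl fun r hr => by
        rw [loopStore_of_lt _ _ _ _ _ _ _ _ (Finset.mem_range.1 hr)]
    rw [mergeStore_loopStore, hlow] at hclear
    have hclear' := runs_clear (B + 7) (loopStore B (fun _ => []) (encodeClauses cs).reverse
      (List.replicate n true) w (List.replicate (R - Q * (blockValues b g w.reverse).sum) true)
      (List.replicate R true) flag' [true])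
    rw [update_loopStore_rest, loopStore_rest] at hclear'
    rcases (Nat.succ_le_of_lt (binValue_lt w)).eq_or_lt with h | h
    · have hinc := runs_increment_overflow (a := B + 4) (t := B + 6) (c := B + 12) (h := B + 11)
        (by omega) (by omega) (by omega) (by omega) (by omega) (by omega)
        (σ := loopStore B (fun _ => []) (encodeClauses cs).reverse
          (List.replicate n true) w [] (List.replicate R true) flag' [true])
        (loopStore_add _ _ _ _ _ _ _ _ 6) (loopStore_add _ _ _ _ _ _ _ _ 12)
        (by rw [loopStore_guess]; exact h)
      rw [loopStore_guess, update_loopStore_guess, update_loopStore_ctrl, loopStore_ctrl] at hinc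
      refine ((hclear.seq (hclear'.seq hinc)).mono ?_).reaches ⟨flag', hF, fun _ => ⟨_, rfl⟩,
        fun h' => absurd h h'.ne⟩
      rw [hw]
      simp only [List.length_replicate]
      omega
    · obtain ⟨w', hw', hv, hinc⟩ := runs_increment (a := B + 4) (t := B + 6) (c := B + 12)
        (h := B + 11) (by omega) (by omega) (by omega)
        (σ := loopStore B (fun _ => []) (encodeClauses cs).reverse
          (List.replicate n true) w [] (List.replicate R true) flag' [true])
        (loopStore_add _ _ _ _ _ _ _ _ 6) (loopStore_add _ _ _ _ _ _ _ _ 12)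
        (by rw [loopStore_guess]; exact h)
      rw [loopStore_guess] at hw' hv
      rw [loopStore_guess, update_loopStore_guess] at hinc
      refine ((hclear.seq (hclear'.seq hinc)).mono ?_).reaches ⟨flag', hF,
        fun h' => absurd h' h.ne, fun _ => ⟨w', hw', hv, rfl⟩⟩
      rw [hw]
      simp only [List.length_replicate]
      omega

/-! ### Enumerating all guesses -/

section enumeration

variable {body : Prog} {r l T : ℕ} {St : List Bool → List Bool → List Bool → Store}

/-- The program `body` turns the state with guess `w` and flag `flag` into the state with the next
guess, and a flag that satisfies `F`. -/
def Advances (body : Prog) (T : ℕ) (St : List Bool → List Bool → List Bool → Store) (q : ℝ≥0∞)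
    (w flag : List Bool) (F : List Bool → Prop) : Prop :=
  Reaches q body (St w flag [true]) T fun σ => ∃ flag', F flag' ∧
    (binValue w + 1 = 2 ^ w.length → ∃ w', σ = St w' flag' []) ∧
    (binValue w + 1 < 2 ^ w.length → ∃ w', w'.length = w.length ∧
      binValue w' = binValue w + 1 ∧ σ = St w' flag' [true])

/-- Here `F` is an invariant of the flag that every round preserves with certainty. The value of the
guess increases until the overflow empties the control stack, so the number of rounds is known. -/
lemma reaches_loop_of_advances (hctrl : ∀ w flag ctrl, St w flag ctrl r = ctrl)
    {F : List Bool → Prop}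
    (h : ∀ w flag, w.length = l → F flag → Advances body T St 1 w flag F) (w flag : List Bool)
    (hw : w.length = l) (hF : F flag) :
    Reaches 1 (.loop r body) (St w flag [true]) ((2 ^ l - binValue w) * (T + 1) + 1) fun σ =>
      ∃ w' flag', F flag' ∧ σ = St w' flag' [] := by
  obtain ⟨j, hj⟩ : ∃ j, j = 2 ^ l - binValue w := ⟨_, rfl⟩
  rw [← hj]
  have hlt := binValue_lt w
  rw [hw] at hlt
  induction j generalizing w flag with
  | zero => omega
  | succ j ih =>
    rw [← one_mul (1 : ℝ≥0∞)]
    refine Reaches.mono (Reaches.loop (by simp [hctrl]) (h w flag hw hF) (q' := 1)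
      (u := j * (T + 1) + 1) ?_) le_rfl (by rw [Nat.succ_mul]; omega) fun _ => id
    rintro σ ⟨flag', hF', hlast, hnext⟩
    rcases (Nat.succ_le_of_lt hlt).eq_or_lt with h1 | h1
    · obtain ⟨w', rfl⟩ := hlast (by rw [hw]; exact h1)
      exact ((runs_loop_nil (hctrl _ _ _)).mono (by omega)).reaches ⟨w', flag', hF', rfl⟩
    · obtain ⟨w', hw', hv, rfl⟩ := hnext (by rw [hw]; exact h1)
      clear hlast hnext
      exact ih w' flag' (hw'.trans hw) hF' (by omega) (by omega)

/-- Before the guess `v` it only matters that each round halts, whatever flag it leaves. The round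
of `v` establishes `F` with probability `q`, and all later rounds preserve it, so `q` is not
diminished. -/
lemma reaches_loop_of_advances_at (hctrl : ∀ w flag ctrl, St w flag ctrl r = ctrl)
    {F : List Bool → Prop} {q : ℝ≥0∞}
    (hany : ∀ w flag, w.length = l → Advances body T St 1 w flag fun _ => True)
    (h : ∀ w flag, w.length = l → F flag → Advances body T St 1 w flag F)
    {v : List Bool} (hv : v.length = l) (hat : ∀ flag, Advances body T St q v flag F)
    (w flag : List Bool) (hw : w.length = l) (hle : binValue w ≤ binValue v) :
    Reaches q (.loop r body) (St w flag [true]) ((2 ^ l - binValue w) * (T + 1) + 1) fun σ =>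
      ∃ w' flag', F flag' ∧ σ = St w' flag' [] := by
  obtain ⟨j, hj⟩ : ∃ j, j = binValue v - binValue w := ⟨_, rfl⟩
  have hlt := binValue_lt w
  have hltv := binValue_lt v
  rw [hw] at hlt
  rw [hv] at hltv
  induction j generalizing w flag with
  | zero =>
    -- Strings of equal length are determined by their values, so the enumeration has arrived at
    -- `v`.
    obtain rfl : w = v := eq_of_binValue_eq (hw.trans hv.symm) (by omega)
    rw [← mul_one q]
    refine Reaches.mono (Reaches.loop (by simp [hctrl]) (hat flag) (q' := 1)
      (u := (2 ^ l - binValue w - 1) * (T + 1) + 1) ?_) le_rfl ?_ fun _ => id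
    · rintro σ ⟨flag', hF', hlast, hnext⟩
      rcases (Nat.succ_le_of_lt hlt).eq_or_lt with h1 | h1
      · obtain ⟨w', rfl⟩ := hlast (by rw [hw]; exact h1)
        exact ((runs_loop_nil (hctrl _ _ _)).mono (by omega)).reaches ⟨w', flag', hF', rfl⟩
      · obtain ⟨w', hw', hv', rfl⟩ := hnext (by rw [hw]; exact h1)
        have := reaches_loop_of_advances hctrl h w' flag' (hw'.trans hw) hF'
        rwa [hv', ← Nat.sub_sub] at this
    · obtain ⟨i, hi⟩ : ∃ i, 2 ^ l - binValue w = i + 1 := ⟨2 ^ l - binValue w - 1, by omega⟩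
      rw [hi, Nat.add_sub_cancel, Nat.succ_mul]
      omega
  | succ j ih =>
    rw [← one_mul q]
    refine Reaches.mono (Reaches.loop (by simp [hctrl]) (hany w flag hw) (q' := q)
      (u := (2 ^ l - binValue w - 1) * (T + 1) + 1) ?_) le_rfl ?_ fun _ => id
    · rintro σ ⟨flag', -, -, hnext⟩
      obtain ⟨w', hw', hv', rfl⟩ := hnext (by rw [hw]; omega)
      clear hnext
      have := ih w' flag' (hw'.trans hw) (by omega) (by omega) (by omega)
      rwa [hv', ← Nat.sub_sub] at this
    · obtain ⟨i, hi⟩ : ∃ i, 2 ^ l - binValue w = i + 1 := ⟨2 ^ l - binValue w - 1, by omega⟩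
      rw [hi, Nat.add_sub_cancel, Nat.succ_mul]
      omega

end enumeration

/-! ### The whole algorithm -/

/-- Read the input and prepare the first guess. -/
def Prog.prepare (B b P : ℕ) : Prog :=
  .seq (.readNat 0 (B + 2) (B + 12)) (.seq (.readNat 0 (B + 13) (B + 12)) (.seq (.move 0 B)
    (.seq (.loop (B + 13) (.seq (.pop (B + 13)) (.seq ((Prog.push (B + 8) true).rep P)
      (.push (B + 14) true))))
    (.seq (.loop (B + 14) (.seq ((Prog.pop (B + 14)).rep (2 ^ b - 1))
      ((Prog.push (B + 4) false).rep b))) (.push (B + 11) true)))))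

lemma runs_loop_goal {a c d P m : ℕ} (hac : a ≠ c) (had : a ≠ d) (hcd : c ≠ d) {σ : Store}
    (ha : σ a = List.replicate m true) :
    Runs (.loop a (.seq (.pop a) (.seq ((Prog.push c true).rep P) (.push d true)))) σ
      (m * (2 * P + 6) + 1) (Function.update (Function.update (Function.update σ a [])
        c (List.replicate (P * m) true ++ σ c)) d (List.replicate m true ++ σ d)) := by
  induction m generalizing σ with
  | zero =>
    refine (runs_loop_nil ha).congr (by omega) ?_
    funext i
    simp only [Function.update_apply]
    split_ifs <;> simp_all
  | succ m ih =>
    refine (Runs.loop (by simp [ha, List.replicate_succ]) ((runs_pop a σ).seq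
      ((runs_rep_push c true P _).seq (runs_push d true _))) (ih ?_)).congr ?_ ?_
    · simp [Function.update_of_ne had, Function.update_of_ne hac, ha]
    · rw [add_mul m 1]
      omega
    · have hP : List.replicate (P * (m + 1)) true =
          List.replicate (P * m) true ++ List.replicate P true := by
        rw [mul_add, mul_one, List.replicate_add]
      have hm : List.replicate (m + 1) true = List.replicate m true ++ [true] :=
        List.replicate_succ'
      rw [hP, hm]
      clear ih hP hm
      funext i
      simp only [Function.update_apply]
      split_ifs <;> simp_all [-List.replicate_append_replicate]

/-- Each round removes `k` ones and popping an empty stack has no effect, so an incomplete last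
group still contributes `b` digits. -/
lemma runs_loop_digits {a c k b : ℕ} (hac : a ≠ c) (hk : 0 < k) (m : ℕ) {σ : Store}
    (ha : σ a = List.replicate m true) :
    Runs (.loop a (.seq ((Prog.pop a).rep k) ((Prog.push c false).rep b))) σ
      (groupCount k m * (2 * k + 2 * b + 4) + 1) (Function.update (Function.update σ a [])
        c (List.replicate (b * groupCount k m) false ++ σ c)) := by
  induction m using Nat.strong_induction_on generalizing σ with
  | _ m ih =>
    rcases Nat.eq_zero_or_pos m with rfl | hm
    · rw [groupCount_zero hk]
      refine (runs_loop_nil ha).congr (by omega) ?_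
      funext i
      simp only [Function.update_apply]
      split_ifs <;> simp_all
    · rw [groupCount_pos_eq hk hm]
      refine (Runs.loop ?_ ((runs_rep_pop a k σ).seq (runs_rep_push c false b _))
        (ih (m - k) (by omega) ?_)).congr ?_ ?_
      · rw [ha, ← List.length_pos_iff, List.length_replicate]
        exact hm
      · simp [Function.update_of_ne hac, ha]
      · rw [add_mul _ 1]
        omega
      · have hb : List.replicate (b * (groupCount k (m - k) + 1)) false =
            List.replicate (b * groupCount k (m - k)) false ++ List.replicate b false := by
          rw [mul_add, mul_one, List.replicate_add]
        rw [hb]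
        clear ih hb
        funext i
        simp only [Function.update_apply]
        split_ifs <;> simp_all [-List.replicate_append_replicate]

lemma exists_runs_prepare (B b P : ℕ) (hB : 0 < B) (hb : 0 < b) :
    ∃ A : ℕ, ∀ (n V : ℕ) (φ : Formula n), n ≤ V → φ.length ≤ V → 1 ≤ V →
      Runs (.prepare B b P) (inputStore (encode φ)) (A * (V * V)) (loopStore B (fun _ => [])
        (encodeClauses (φ.map Clause.toRaw)).reverse (List.replicate n true)
        (List.replicate (b * groupCount (2 ^ b - 1) φ.length) false) []
        (List.replicate (P * φ.length) true) [] [true]) := by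
  have hk : 0 < 2 ^ b - 1 := by
    have := Nat.one_lt_two_pow hb.ne'
    omega
  refine ⟨200 + 2 * P + 2 * (2 ^ b - 1) + 2 * b, ?_⟩
  intro n V φ hn hm hV1
  have hB1 : B ≠ 0 := hB.ne'
  refine ((runs_readNat (i := n) (w := encodeNat φ.length ++
      encodeClauses (φ.map Clause.toRaw)) (by omega) (by omega) (by omega) ?_ ?_).seq
    ((runs_readNat (i := φ.length) (w := encodeClauses (φ.map Clause.toRaw)) (by omega) (by omega)
      (by omega) ?_ ?_).seq
    ((runs_move (w := encodeClauses (φ.map Clause.toRaw)) (by omega) ?_).seq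
    ((runs_loop_goal (P := P) (m := φ.length) (by omega) (by omega) (by omega) ?_).seq
    ((runs_loop_digits (b := b) (k := 2 ^ b - 1) (by omega) hk φ.length ?_).seq
    (runs_push _ _ _)))))).congr ?_ ?_
  · simp [inputStore, encode_eq]
  · simp [inputStore]
  · simp [inputStore]
  · simp [inputStore]
  · simp [inputStore]
  · simp [inputStore]
  · simp [inputStore]
  · have hd := length_encodeClauses_le (cs := φ.map Clause.toRaw) (V := V) (by
      intro cl hcl
      obtain ⟨c, -, rfl⟩ := List.mem_map.1 hcl
      exact c.toRaw_bounded.mono hn)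
    rw [List.length_map] at hd
    have hVV : V ≤ V * V := Nat.le_mul_of_pos_left V hV1
    have h1 : φ.length * (3 * V + 3) ≤ 6 * (V * V) := by
      calc φ.length * (3 * V + 3) ≤ V * (6 * V) := Nat.mul_le_mul hm (by omega)
        _ = _ := by ring
    have h2 : φ.length * (2 * P + 6) ≤ (2 * P + 6) * (V * V) := by
      rw [mul_comm]
      exact Nat.mul_le_mul_left _ (hm.trans hVV)
    have h3 : groupCount (2 ^ b - 1) φ.length * (2 * (2 ^ b - 1) + 2 * b + 4) ≤
        (2 * (2 ^ b - 1) + 2 * b + 4) * (V * V) := by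
      rw [mul_comm]
      exact Nat.mul_le_mul_left _ ((groupCount_le hk _).trans (hm.trans hVV))
    generalize 2 ^ b - 1 = k at *
    calc _ ≤ (2 * P + 6) * (V * V) + (2 * k + 2 * b + 4) * (V * V) + 190 * (V * V) := by omega
      _ = _ := by ring
  · refine eq_loopStore _ _ _ _ _ _ _ _ (fun r hr => ?_) fun j => ?_
    · have hne : ∀ j, r ≠ B + j := fun j => by omega
      have hne' : r ≠ B := by omega
      by_cases h : r = 0
      · subst h
        simp [hne']
      · simp [inputStore, h, hne, hne']
    · simp [Function.update_apply, loopStore_add, inputStore, hB1]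
      split_ifs <;> (subst_vars; simp)
      split <;> first | rfl | contradiction

/-- Try all guesses, and accept if the subroutine `p` has accepted for one of them. -/
def Prog.withGuesses (B b P Q : ℕ) (p : Prog) : Prog :=
  .seq (.prepare B b P) (.seq (.loop (B + 11) (.tryGuess B b Q p))
    (.branch (B + 10) (.push 1 true) (.push 1 true) .nop))

lemma binValue_replicate_false (l : ℕ) : binValue (List.replicate l false) = 0 := by
  induction l with
  | zero => rfl
  | succ l ih => simp [List.replicate_succ, binValue, ih]

/-- The three conclusions are three choices of the predicate on the flag: no condition for halting,
an empty flag for rejection, and a nonempty flag for acceptance. For the last, a nonempty flag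
persists, since a round only ever pushes on it. -/
lemma exists_reaches_withGuesses (B b P Q : ℕ) (p : Prog) (hB : 1 < B) (hp : p.Below B)
    (hb : 0 < b) :
    ∃ A : ℕ, ∀ (n V t : ℕ) (φ : Formula n), n + φ.length * blockSize (2 ^ b - 1) ≤ V →
      φ.length ≤ V → 1 ≤ V → ∀ g, g = groupCount (2 ^ b - 1) φ.length →
      ∀ Good : List Bool → Prop, (∀ w, Good w ↔ w.length = b * g ∧
        P * φ.length ≤ Q * (blockValues b g w.reverse).sum) →
      (∀ w, Good w → Reaches 1 p (inputStore (guessInput b n g (φ.map Clause.toRaw) w)) t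
        fun _ => True) →
      Reaches 1 (.withGuesses B b P Q p) (inputStore (encode φ))
        (2 ^ (b * g) * (A * (V * V) + 3 * t)) (fun _ => True) ∧
      ((∀ w, Good w → Reaches 1 p (inputStore (guessInput b n g (φ.map Clause.toRaw) w)) t
        fun σ => ¬ Accepting σ) → Reaches 1 (.withGuesses B b P Q p) (inputStore (encode φ))
        (2 ^ (b * g) * (A * (V * V) + 3 * t)) fun σ => ¬ Accepting σ) ∧
      ∀ q ≤ 1, (∃ w, Good w ∧ Reaches q p (inputStore (guessInput b n g (φ.map Clause.toRaw) w)) t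
        Accepting) → Reaches q (.withGuesses B b P Q p) (inputStore (encode φ))
        (2 ^ (b * g) * (A * (V * V) + 3 * t)) Accepting := by
  obtain ⟨A₁, hA₁⟩ := exists_runs_prepare B b P (by omega) hb
  obtain ⟨A₂, hA₂⟩ := exists_reaches_tryGuess B b Q p hB hp hb
  refine ⟨A₁ + A₂ + 14 * P + 20, ?_⟩
  intro n V t φ hV hm hV1 g hg Good hGood hhalt
  have hk : 0 < 2 ^ b - 1 := by
    have := Nat.one_lt_two_pow hb.ne'
    omega
  have hgm : g ≤ φ.length := hg ▸ groupCount_le hk _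
  have hcs : ∀ cl ∈ φ.map Clause.toRaw, cl.Bounded n := by
    intro cl hcl
    obtain ⟨c, -, rfl⟩ := List.mem_map.1 hcl
    exact c.toRaw_bounded
  have hVg : n + g * blockSize (2 ^ b - 1) ≤ V :=
    (Nat.add_le_add_left (Nat.mul_le_mul_right _ hgm) n).trans hV
  have hprep := hA₁ n V φ (by omega) hm hV1
  rw [← hg] at hprep
  set St : List Bool → List Bool → List Bool → Store := fun w flag ctrl =>
    loopStore B (fun _ => []) (encodeClauses (φ.map Clause.toRaw)).reverse (List.replicate n true)
      w [] (List.replicate (P * φ.length) true) flag ctrl with hSt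
  set T := A₂ * (V * V) + 14 * (P * φ.length) + 3 * t with hT
  have hctrl : ∀ w flag ctrl, St w flag ctrl (B + 11) = ctrl := fun w flag ctrl =>
    loopStore_ctrl _ _ _ _ _ _ _ _
  have hadv : ∀ (q : ℝ≥0∞) (w flag : List Bool) (F : List Bool → Prop), q ≤ 1 →
      w.length = b * g →
      (Good w → Reaches q p (inputStore (guessInput b n g (φ.map Clause.toRaw) w)) t fun σ =>
        (Accepting σ → F (true :: flag)) ∧ (¬ Accepting σ → F flag)) →
      (¬ Good w → F flag) → Advances (.tryGuess B b Q p) T St q w flag F := by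
    intro q w flag F hq hw h1 h2
    refine hA₂ n g (P * φ.length) V t (φ.map Clause.toRaw) w flag q F hq hw hcs ?_ hVg
      (hgm.trans hm) (by simpa using hm) hV1 (fun h => h1 ((hGood w).2 ⟨hw, h⟩))
      fun h => h2 fun h' => h ((hGood w).1 h').2
    rw [List.length_map, hg]
    exact le_groupCount_mul hk _
  have hfinish : ∀ (q : ℝ≥0∞) (F : List Bool → Prop) (S : Store → Prop),
      (∀ flag, F flag → flag = [] → ∀ σ : Store, σ 1 = [] → S σ) →
      (∀ flag, F flag → flag ≠ [] → ∀ σ : Store, σ 1 = [true] → S σ) →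
      Reaches q (.loop (B + 11) (.tryGuess B b Q p)) (St (List.replicate (b * g) false) [] [true])
        ((2 ^ (b * g) - binValue (List.replicate (b * g) false)) * (T + 1) + 1)
        (fun σ => ∃ w' flag', F flag' ∧ σ = St w' flag' []) →
      Reaches q (.withGuesses B b P Q p) (inputStore (encode φ))
        (2 ^ (b * g) * ((A₁ + A₂ + 14 * P + 20) * (V * V) + 3 * t)) S := by
    intro q F S hnil hcons hloop
    rw [binValue_replicate_false, Nat.sub_zero] at hloop
    have hbranch : ∀ w' flag', F flag' → Reaches 1
        (.branch (B + 10) (.push 1 true) (.push 1 true) .nop) (St w' flag' []) 2 S := by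
      intro w' flag' hF
      have hflag : St w' flag' [] (B + 10) = flag' := loopStore_flag _ _ _ _ _ _ _ _
      have hone : St w' flag' [] 1 = [] := loopStore_of_lt _ _ _ _ _ _ _ _ hB
      rcases hf : flag' with _ | ⟨_ | _, l⟩
      · subst hf
        exact reaches_branch_nil hflag ((runs_nop _).reaches (hnil _ hF rfl _ hone))
      · rw [← hf]
        exact reaches_branch_false (hflag.trans hf) ((runs_push _ _ _).reaches
          (hcons _ hF (by simp [hf]) _ (by simp [hone])))
      · rw [← hf]
        exact reaches_branch_true (hflag.trans hf) ((runs_push _ _ _).reaches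
          (hcons _ hF (by simp [hf]) _ (by simp [hone])))
    rw [← mul_one q]
    refine Reaches.mono (hprep.seq_reaches (Reaches.seq hloop (q' := 1) (u := 2) ?_))
      le_rfl ?_ fun _ => id
    · rintro _ ⟨w', flag', hF, rfl⟩
      exact hbranch w' flag' hF
    · have hVV : V ≤ V * V := Nat.le_mul_of_pos_left V hV1
      have h1 : P * φ.length ≤ P * (V * V) := Nat.mul_le_mul_left P (hm.trans hVV)
      have h2 : 1 ≤ 2 ^ (b * g) := Nat.one_le_two_pow
      generalize 2 ^ (b * g) = N at *
      have h3 : A₁ * (V * V) ≤ N * (A₁ * (V * V)) := Nat.le_mul_of_pos_left _ h2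
      have h4 : N * (T + 1) ≤ N * (A₂ * (V * V) + 14 * (P * (V * V)) + 3 * t + 1) :=
        Nat.mul_le_mul_left N (by omega)
      have h5 : N ≤ N * (V * V) := Nat.le_mul_of_pos_right N (by omega)
      calc _ ≤ N * (A₁ * (V * V)) + N * (A₂ * (V * V) + 14 * (P * (V * V)) + 3 * t + 1) +
            19 * (N * (V * V)) := by omega
        _ = N * (A₁ * (V * V) + A₂ * (V * V) + 14 * (P * (V * V)) + 3 * t) + N +
            19 * (N * (V * V)) := by ring
        _ ≤ N * (A₁ * (V * V) + A₂ * (V * V) + 14 * (P * (V * V)) + 3 * t) + N * (V * V) +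
            19 * (N * (V * V)) := by omega
        _ = _ := by ring
  have hlen : (List.replicate (b * g) false).length = b * g := List.length_replicate
  refine ⟨?_, fun hno => ?_, fun q hq ⟨v, hv, hyes⟩ => ?_⟩
  · refine hfinish 1 (fun _ => True) _ (fun _ _ _ _ _ => trivial) (fun _ _ _ _ _ => trivial)
      (reaches_loop_of_advances hctrl (fun w flag hw _ => ?_) _ _ hlen trivial)
    exact hadv 1 w flag _ le_rfl hw (fun h => (hhalt w h).mono le_rfl le_rfl (by simp)) (by simp)
  · refine hfinish 1 (fun flag => flag = []) _
      (fun _ _ _ σ h => by simp [Accepting, h]) (fun _ h h' => absurd h h')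
      (reaches_loop_of_advances hctrl (fun w flag hw hF => ?_) _ _ hlen rfl)
    exact hadv 1 w flag _ le_rfl hw (fun h => (hno w h).mono le_rfl le_rfl
      fun σ hσ => ⟨fun h => absurd h hσ, fun _ => hF⟩) fun _ => hF
  · have hv' := ((hGood v).1 hv).1
    refine hfinish q (fun flag => flag ≠ []) _ (fun _ h h' => absurd h' h)
      (fun _ _ _ σ h => by simp [Accepting, h])
      (reaches_loop_of_advances_at hctrl (fun w flag hw => ?_) (fun w flag hw hF => ?_) hv'
        (fun flag => ?_) _ _ hlen (by rw [binValue_replicate_false]; omega))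
    · exact hadv 1 w flag _ le_rfl hw (fun h => (hhalt w h).mono le_rfl le_rfl (by simp)) (by simp)
    · exact hadv 1 w flag _ le_rfl hw (fun h => (hhalt w h).mono le_rfl le_rfl
        fun σ _ => ⟨fun _ => by simp, fun _ => hF⟩) fun _ => hF
    · exact hadv q v flag _ hq hv' (fun _ => hyes.mono le_rfl le_rfl
        fun σ hσ => ⟨fun _ => by simp, fun h => absurd hσ h⟩) fun h => absurd hv h

/-! ### The running time -/

lemma exists_blockLength (ρ : ℕ) {η : ℝ} (hη : 0 < η) :
    ∃ b : ℕ, 0 < b ∧ (b * ρ : ℝ) ≤ η * ((2 ^ b - 1 : ℕ) : ℝ) := by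
  have h := tendsto_pow_const_mul_const_pow_of_abs_lt_one 1 (r := (1 / 2 : ℝ))
    (by rw [abs_of_pos] <;> norm_num)
  -- The factor `2` pays for passing from `2 ^ b` to `2 ^ b - 1 ≥ 2 ^ (b - 1)`, and `ρ + 1` avoids a
  -- division by zero.
  have hev := (h.eventually_lt_const (u := η / (2 * (ρ + 1))) (by positivity)).and
    (Filter.eventually_gt_atTop 0)
  obtain ⟨b, hb, hb0⟩ := hev.exists
  refine ⟨b, hb0, ?_⟩
  have h2 : (1 : ℝ) ≤ 2 ^ (b - 1) := one_le_pow₀ (by norm_num)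
  have h3 : (2 : ℝ) ^ b = 2 * 2 ^ (b - 1) := by
    rw [← pow_succ']
    congr 1
    omega
  rw [pow_one, one_div, inv_pow, ← div_eq_mul_inv, div_lt_div_iff₀ (by positivity)
    (by positivity)] at hb
  rw [Nat.cast_sub Nat.one_le_two_pow]
  push_cast
  have hb' : (0 : ℝ) < b := by exact_mod_cast hb0
  nlinarith

/-- The right-hand power is the square of an exponential `exp (a n)`, which is at least `a n + 1`.
-/
lemma exists_sq_le_rpow {η : ℝ} (hη : 0 < η) :
    ∃ C : ℝ, 0 ≤ C ∧ ∀ n : ℕ, ((n : ℝ) + 1) ^ 2 ≤ C * (2 : ℝ) ^ (η * n) := by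
  have hlog : 0 < Real.log 2 := Real.log_pos (by norm_num)
  set a : ℝ := η / 2 * Real.log 2 with ha
  have ha0 : 0 < a := by positivity
  refine ⟨(1 / a + 1) ^ 2, by positivity, fun n => ?_⟩
  have h1 : (2 : ℝ) ^ (η * n) = Real.exp (a * n) ^ 2 := by
    rw [Real.rpow_def_of_pos (by norm_num), ← Real.exp_nat_mul]
    congr 1
    rw [ha]
    push_cast
    ring
  have h2 : a * n + 1 ≤ Real.exp (a * n) := Real.add_one_le_exp _
  have h3 : (n : ℝ) + 1 ≤ (1 / a + 1) * Real.exp (a * n) := by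
    have hn : (0 : ℝ) ≤ n := n.cast_nonneg
    have h4 : (n : ℝ) ≤ 1 / a * Real.exp (a * n) := by
      rw [one_div, inv_mul_eq_div, le_div_iff₀ ha0]
      linarith
    have h5 : (1 : ℝ) ≤ Real.exp (a * n) := Real.one_le_exp (by positivity)
    linarith
  rw [h1, ← mul_pow]
  exact pow_le_pow_left₀ (by positivity) h3 2

/-! ### Monotonicity in the promise, and the total running time -/

lemma SolvesWithin.mono {p : Prog} {c c' s s' : ℝ} {ρ : ℕ} {T T' : ℕ → ℝ}
    (h : SolvesWithin p c s ρ T) (hc : c ≤ c') (hs : s' ≤ s) (hT : ∀ n, T n ≤ T' n) :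
    SolvesWithin p c' s' ρ T' := by
  intro n φ hφ
  obtain ⟨t, ht, hhalt, hyes, hno⟩ := h n φ hφ
  exact ⟨t, ht.trans (hT n), hhalt, fun hy => hyes ⟨hy.1, hy.2.imp fun x hx => hc.trans hx⟩,
    fun hn => hno ⟨hn.1, fun x => (hn.2 x).trans hs⟩⟩

lemma HasSubexpAlgorithm.mono {c c' s s' : ℝ} (h : HasSubexpAlgorithm c s) (hc : c ≤ c')
    (hs : s' ≤ s) : HasSubexpAlgorithm c' s' := by
  intro ρ δ hδ
  obtain ⟨p, C, hp⟩ := h ρ δ hδ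
  exact ⟨p, C, hp.mono hc hs fun _ => le_rfl⟩

/-- The running time of the enumeration of the guesses is subexponential. -/
lemma exists_time_bound {ρ b L A : ℕ} {δ C : ℝ} (hδ : 0 < δ) (hb : 0 < b)
    (hbρ : (b * ρ : ℝ) ≤ δ / 4 * ((2 ^ b - 1 : ℕ) : ℝ)) :
    ∃ D : ℝ, ∀ n m t : ℕ, m ≤ ρ * n →
      (t : ℝ) ≤ C * (2 : ℝ) ^ (δ / (4 * (1 + ρ * L)) *
        ((n + groupCount (2 ^ b - 1) m * L : ℕ) : ℝ)) →
      ((2 ^ (b * groupCount (2 ^ b - 1) m) *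
        (A * ((n + m * L + m + 1) * (n + m * L + m + 1)) + 3 * t) : ℕ) : ℝ) ≤
        D * (2 : ℝ) ^ (δ * (n : ℝ)) := by
  obtain ⟨E, hE0, hE⟩ := exists_sq_le_rpow (η := δ / 4) (by positivity)
  have hk : 0 < 2 ^ b - 1 := by
    have := Nat.one_lt_two_pow hb.ne'
    omega
  -- The factor `2 ^ b` accounts for the incomplete last group, and `|C|` is used because the sign
  -- of `C` is unknown.
  refine ⟨2 ^ b * (A * (1 + ρ * L + ρ) ^ 2 * E + 3 * |C|), fun n m t hm ht => ?_⟩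
  set g := groupCount (2 ^ b - 1) m with hg
  have hm' : (m : ℝ) ≤ ρ * n := by exact_mod_cast hm
  have hn : (0 : ℝ) ≤ n := n.cast_nonneg
  have hgm : (g : ℝ) ≤ m := by exact_mod_cast groupCount_le hk m
  have hX : 1 ≤ (2 : ℝ) ^ (δ / 4 * n) :=
    Real.one_le_rpow (by norm_num) (by positivity)
  set X : ℝ := (2 : ℝ) ^ (δ / 4 * n) with hXdef
  -- With `k = 2 ^ b - 1`, `g * k ≤ m + k` gives `b * g ≤ b + b * ρ * n / k`, and `b` was chosen so
  -- that the last term is at most `δ / 4 * n`.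
  have hguess : (2 : ℝ) ^ (b * g) ≤ 2 ^ b * X := by
    have h1 : ((b * g : ℕ) : ℝ) ≤ b + δ / 4 * n := by
      have h2 : ((g * (2 ^ b - 1) : ℕ) : ℝ) ≤ ((m + (2 ^ b - 1) : ℕ) : ℝ) := by
        exact_mod_cast groupCount_mul_le m
      have hk' : (0 : ℝ) < ((2 ^ b - 1 : ℕ) : ℝ) := by exact_mod_cast hk
      rw [Nat.cast_mul, Nat.cast_add] at h2
      rw [Nat.cast_mul]
      generalize ((2 ^ b - 1 : ℕ) : ℝ) = k at *
      have h3 : b * g * k ≤ (b + δ / 4 * n) * k := by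
        have hb' : (0 : ℝ) ≤ b := b.cast_nonneg
        calc b * g * k = b * (g * k) := by ring
          _ ≤ b * (ρ * n + k) := mul_le_mul_of_nonneg_left (by linarith) hb'
          _ = b * ρ * n + b * k := by ring
          _ ≤ δ / 4 * k * n + b * k := by
            have := mul_le_mul_of_nonneg_right hbρ hn
            linarith
          _ = _ := by ring
      exact le_of_mul_le_mul_right h3 hk'
    calc (2 : ℝ) ^ (b * g) = (2 : ℝ) ^ ((b * g : ℕ) : ℝ) := (Real.rpow_natCast _ _).symm
      _ ≤ (2 : ℝ) ^ ((b : ℝ) + δ / 4 * n) := Real.rpow_le_rpow_of_exponent_le (by norm_num) h1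
      _ = _ := by rw [Real.rpow_add (by norm_num), Real.rpow_natCast]
  have ht' : (t : ℝ) ≤ |C| * X := by
    refine ht.trans ((mul_le_mul_of_nonneg_right (le_abs_self C) (by positivity)).trans ?_)
    refine mul_le_mul_of_nonneg_left ?_ (abs_nonneg C)
    refine Real.rpow_le_rpow_of_exponent_le (by norm_num) ?_
    rw [div_mul_eq_mul_div, div_le_iff₀ (by positivity)]
    push_cast
    have hL : (0 : ℝ) ≤ L := L.cast_nonneg
    have h1 : (g : ℝ) * L ≤ ρ * n * L := mul_le_mul_of_nonneg_right (hgm.trans hm') hL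
    have h2 : δ * (n + g * L) ≤ δ * (n + ρ * n * L) :=
      mul_le_mul_of_nonneg_left (by linarith) hδ.le
    calc δ * (n + g * L) ≤ δ * (n + ρ * n * L) := h2
      _ = _ := by ring
  have hsize : ((n : ℝ) + m * L + m + 1) ≤ (1 + ρ * L + ρ) * (n + 1) := by
    have hL : (0 : ℝ) ≤ L := L.cast_nonneg
    have h1 : (m : ℝ) * L ≤ ρ * n * L := mul_le_mul_of_nonneg_right hm' hL
    have h2 : (0 : ℝ) ≤ ρ * L := by positivity
    have h3 : (0 : ℝ) ≤ ρ := by positivity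
    linarith
  have hsq : ((n : ℝ) + m * L + m + 1) * (n + m * L + m + 1) ≤
      (1 + ρ * L + ρ) ^ 2 * (E * X) := by
    calc ((n : ℝ) + m * L + m + 1) * (n + m * L + m + 1)
        ≤ ((1 + ρ * L + ρ) * (n + 1)) * ((1 + ρ * L + ρ) * (n + 1)) :=
          mul_le_mul hsize hsize (by positivity) (by positivity)
      _ = (1 + ρ * L + ρ) ^ 2 * ((n + 1) ^ 2) := by ring
      _ ≤ _ := mul_le_mul_of_nonneg_left (hE n) (by positivity)
  -- One factor `X` comes from the number of guesses, the other from the cost of one guess; together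
  -- they use only half of the exponent `δ * n`.
  have hXX : X * X ≤ (2 : ℝ) ^ (δ * (n : ℝ)) := by
    rw [hXdef, ← Real.rpow_add (by norm_num)]
    refine Real.rpow_le_rpow_of_exponent_le (by norm_num) ?_
    nlinarith
  push_cast
  calc (2 : ℝ) ^ (b * g) * (A * ((n + m * L + m + 1) * (n + m * L + m + 1)) + 3 * t)
      ≤ (2 ^ b * X) * (A * ((1 + ρ * L + ρ) ^ 2 * (E * X)) + 3 * (|C| * X)) := by
        refine mul_le_mul hguess (add_le_add (mul_le_mul_of_nonneg_left hsq (by positivity))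
          (by linarith)) (by positivity) (by positivity)
    _ = 2 ^ b * (A * (1 + ρ * L + ρ) ^ 2 * E + 3 * |C|) * (X * X) := by ring
    _ ≤ _ := mul_le_mul_of_nonneg_left hXX (by positivity)

/-! ### The equivalence -/

lemma one_half_le_one : (1 / 2 : ℝ≥0∞) ≤ 1 := by
  rw [one_div]
  exact ENNReal.inv_le_one.2 one_le_two

theorem hasSubexpAlgorithm_of_perfect (H : ∀ γ : ℝ, 0 < γ → HasSubexpAlgorithm 1 (1 - γ))
    {c s : ℝ} (hs : 0 < s) (hsc : s < c) : HasSubexpAlgorithm c s := by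
  intro ρ δ hδ
  -- A rational threshold lets the machine compare `P * m` with `Q` times the sum of the guess in
  -- integers.
  obtain ⟨r, hsr, hrc⟩ := exists_rat_btwn hsc
  have hr0 : 0 < r := by exact_mod_cast hs.trans hsr
  obtain ⟨P, hP⟩ : ∃ P : ℕ, r.num = P := ⟨r.num.toNat, by
    rw [Int.toNat_of_nonneg (Rat.num_nonneg.2 hr0.le)]⟩
  have hQ : 0 < r.den := r.den_pos
  have hrPQ : (r : ℝ) = (P : ℝ) / (r.den : ℝ) := by
    have : (r : ℝ) = ((r.num : ℤ) : ℝ) / (r.den : ℝ) := by exact_mod_cast (Rat.num_div_den r).symm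
    rw [this, hP, Int.cast_natCast]
  generalize r.den = Q at *
  rw [hrPQ] at hsr hrc
  obtain ⟨b, hb, hbρ⟩ := exists_blockLength ρ (η := δ / 4) (by positivity)
  have hk : 0 < 2 ^ b - 1 := by
    have := Nat.one_lt_two_pow hb.ne'
    omega
  have hK := gadgetSize_pos (2 ^ b - 1)
  have hγ : 0 < (P / Q - s) / (((2 ^ b - 1 : ℕ) : ℝ) * gadgetSize (2 ^ b - 1)) := by
    have h1 : (0 : ℝ) < ((2 ^ b - 1 : ℕ) : ℝ) := by exact_mod_cast hk
    have h2 : (0 : ℝ) < gadgetSize (2 ^ b - 1) := by exact_mod_cast hK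
    have h3 : 0 < (P : ℝ) / Q - s := by linarith
    positivity
  -- The gadget formula has `gadgetSize` clauses per group and at least one variable per group, so
  -- that constant bounds its density. It has at most `(1 + ρ * blockSize) * n` variables, which the
  -- smaller exponent compensates.
  obtain ⟨p, C, hp⟩ := H _ hγ (gadgetSize (2 ^ b - 1))
    (δ / (4 * (1 + ρ * blockSize (2 ^ b - 1)))) (by positivity)
  obtain ⟨B₀, hB₀⟩ := p.exists_below
  -- Adding `2` makes sure that the input stack `0` and the answer stack `1` count among the stacks
  -- of the subroutine.
  obtain ⟨A, hA⟩ := exists_reaches_withGuesses (B₀ + 2) b P Q p (by omega)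
    (hB₀.mono (by omega)) hb
  obtain ⟨D, hD⟩ := exists_time_bound (ρ := ρ) (L := blockSize (2 ^ b - 1)) (A := A) (C := C)
    hδ hb hbρ
  refine ⟨.withGuesses (B₀ + 2) b P Q p, D, fun n φ hφ => ?_⟩
  set k := 2 ^ b - 1 with hkdef
  obtain ⟨g, hg⟩ : ∃ g, g = groupCount k φ.length := ⟨_, rfl⟩
  -- All guesses give formulas with the same number of variables, so a single time bound serves for
  -- all calls, although the subroutine's own `t'` may vary.
  set t := ⌊C * (2 : ℝ) ^ (δ / (4 * (1 + ρ * blockSize k)) *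
    ((n + groupCount k φ.length * blockSize k : ℕ) : ℝ))⌋₊ with htdef
  have hcs : ∀ cl ∈ φ.map Clause.toRaw, cl.Bounded n := by
    intro cl hcl
    obtain ⟨c, -, rfl⟩ := List.mem_map.1 hcl
    exact c.toRaw_bounded
  have hψ : ∀ w, ∃ (ψ : Formula (n + g * blockSize k)) (t' : ℕ),
      ψ.map Clause.toRaw = thresholdClauses k n (blockValues b g w) (φ.map Clause.toRaw) ∧
      encode ψ = guessInput b n g (φ.map Clause.toRaw) w.reverse ∧
      (t' : ℝ) ≤ C * (2 : ℝ) ^ (δ / (4 * (1 + ρ * blockSize k)) *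
        ((n + groupCount k φ.length * blockSize k : ℕ) : ℝ)) ∧
      HaltsWithin p (encode ψ) t' ∧ (IsYes 1 ψ → 1 / 2 ≤ acceptProb p (encode ψ) t') ∧
      (IsNo (1 - (P / Q - s) / ((k : ℝ) * gadgetSize k)) ψ → acceptProb p (encode ψ) t' = 0) := by
    intro w
    have hbd := thresholdClauses_bounded (o := n) (blockValues_le b g w) hcs
    rw [length_blockValues] at hbd
    obtain ⟨ψ, hψ⟩ := exists_formula _ hbd
    have hlen : ψ.length = g * gadgetSize k := by
      rw [← List.length_map (f := Clause.toRaw), hψ, length_thresholdClauses, length_blockValues]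
    have hL : 0 < blockSize k := by unfold blockSize; positivity
    obtain ⟨t', ht', h⟩ := hp _ ψ (by
      rw [hlen, mul_comm]
      refine Nat.mul_le_mul_left _ ?_
      exact (Nat.le_mul_of_pos_right g hL).trans (Nat.le_add_left _ _))
    refine ⟨ψ, t', hψ, ?_, by rw [← hg]; exact ht', h⟩
    rw [encode_eq, hψ, hlen, guessInput, List.reverse_reverse]
  -- The bound is nonnegative because it dominates the running time on some formula; the empty
  -- string is an arbitrary choice of digits.
  have ht0 : 0 ≤ C * (2 : ℝ) ^ (δ / (4 * (1 + ρ * blockSize k)) *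
      ((n + groupCount k φ.length * blockSize k : ℕ) : ℝ)) := by
    obtain ⟨-, t', -, -, ht', -⟩ := hψ []
    exact t'.cast_nonneg.trans ht'
  have hmain := hA n (n + φ.length * blockSize k + φ.length + 1) t φ (by omega) (by omega)
    (by omega) g hg (fun w => w.length = b * g ∧
      P * φ.length ≤ Q * (blockValues b g w.reverse).sum) (fun w => Iff.rfl) (by
      intro w _
      obtain ⟨ψ, t', -, henc, ht', hhalt, -⟩ := hψ w.reverse
      rw [List.reverse_reverse] at henc
      rw [← henc]
      exact (haltsWithin_iff.1 hhalt).mono le_rfl (Nat.le_floor ht') fun _ => id)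
  obtain ⟨hhalts, hrejects, haccepts⟩ := hmain
  refine ⟨_, ?_, haltsWithin_iff.2 hhalts, fun hyes => ?_, fun hno => ?_⟩
  · rw [hg]
    exact hD n φ.length t hφ (Nat.floor_le ht0)
  · rw [acceptProb_eq]
    obtain ⟨hne, x, hx⟩ := hyes
    have hm : 0 < φ.length := List.length_pos_iff.2 hne
    obtain ⟨X, hX⟩ := exists_assignment x
    obtain ⟨v, hv, hvs⟩ := exists_blockValues_eq b (satCounts k X g (φ.map Clause.toRaw))
      (satCounts_le k X g _)
    rw [length_satCounts] at hv hvs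
    -- The good guess consists of the true counts of the assignment, reversed because the program
    -- reads the digits of a guess backwards.
    refine haccepts (1 / 2) one_half_le_one ⟨v.reverse, ⟨by simpa using hv, ?_⟩, ?_⟩
    · rw [List.reverse_reverse, hvs, sum_satCounts X g _ (by
        rw [List.length_map, hg]
        exact le_groupCount_mul hk _), countP_toRaw φ hX]
      have hm' : (0 : ℝ) < φ.length := by exact_mod_cast hm
      have hQ' : (0 : ℝ) < Q := by exact_mod_cast hQ
      have h := hrc.le.trans hx
      rw [satFraction, div_le_div_iff₀ hQ' hm', mul_comm _ (Q : ℝ)] at h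
      exact_mod_cast h
    · obtain ⟨ψ, t', hmap, henc, ht', -, hacc, -⟩ := hψ v
      rw [← henc]
      rw [hvs] at hmap
      have h := hacc (isYes_of_satCounts (hg ▸ groupCount_pos hk hm) hmap)
      rw [acceptProb_eq] at h
      exact Reaches.mono h le_rfl (Nat.le_floor ht') fun _ => id
  · rw [acceptProb_eq_zero_iff (haltsWithin_iff.2 hhalts)]
    have hm : 0 < φ.length := List.length_pos_iff.2 hno.1
    refine hrejects fun w ⟨hw, hsum⟩ => ?_
    obtain ⟨ψ, t', hmap, henc, ht', hhalt, -, hrej⟩ := hψ w.reverse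
    rw [List.reverse_reverse] at henc
    rw [← henc]
    have h := hrej (isNo_of_thresholds hQ hsr hk (blockValues_le b g w.reverse)
      (by rw [length_blockValues, hg]; exact groupCount_pos hk hm)
      (by rw [length_blockValues, hg]; exact groupCount_le hk _) hsum hmap hno)
    rw [acceptProb_eq_zero_iff hhalt] at h
    exact h.mono le_rfl (Nat.le_floor ht') fun _ => id

end MaxSat

theorem theorem3 :
    (∀ γ : ℝ, 0 < γ → MaxSat.HasSubexpAlgorithm 1 (1 - γ)) ↔
      (∀ s ε : ℝ, 0 < s → 0 < ε → MaxSat.HasSubexpAlgorithm (s * (1 + ε)) s) := by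
  refine ⟨fun H s ε hs hε => ?_, fun H γ hγ => ?_⟩
  · exact MaxSat.hasSubexpAlgorithm_of_perfect H hs (by nlinarith)
  · have hpos : 0 < max (1 - γ) (1 / 2) := lt_max_of_lt_right (by norm_num)
    have hlt : max (1 - γ) (1 / 2) < 1 := max_lt (by linarith) (by norm_num)
    refine (H (max (1 - γ) (1 / 2)) (1 / max (1 - γ) (1 / 2) - 1) hpos ?_).mono ?_
      (le_max_left _ _)
    · rw [sub_pos, lt_div_iff₀ hpos]
      linarith
    · rw [add_sub_cancel, mul_one_div_cancel hpos.ne']
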